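/- Consider a full-duplex decode-and-forward relay with $M_R\ge 1$ receive and $M_T>1$ transmit antennas that harvests energy from the source during a fraction $\alpha\in(0,1)$ of each block with conversion efficiency $\eta>0$. Put $\kappa=\frac{\eta\alpha}{1-\alpha}$; let $d_1,d_2>0$ be the source–relay and relay–destination distances and $\tau$ the path loss exponent. The channels $h_{SR}\in\mathbb C^{M_R\times 1}$, $H_{RR}\in\mathbb C^{M_R\times M_T}$ (loopback interference), $h_{RD}\in\mathbb C^{1\times M_T}$ have jointly independent, circularly symmetric complex Gaussian entries with mean $0$, of variance $1$ for $h_{SR}$ and $h_{RD}$ and of variance $\sigma^2>0$ for $H_{RR}$. With source power (first-hop SNR) $\rho_1$, combining vector $w_r$ and beamforming vector $w_t$ the end-to-end SINR is $$\gamma=\min\left(\frac{\rho_1|w_rh_{SR}|^2}{\kappa\rho_1\|h_{SR}\|^2|w_rH_{RR}w_t|^2+d_1^{\tau}},\ \frac{\kappa\rho_1}{d_1^{\tau}d_2^{\tau}}\|h_{SR}\|^2|h_{RD}w_t|^2\right).$$ In the transmit zero-forcing (TZF) scheme, $w_r=h_{SR}^\dagger/\|h_{SR}\|$ and $w_t$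 maximizes $|h_{RD}w_t|^2$ subject to $\|w_t\|=1$ and $h_{SR}^\dagger H_{RR}w_t=0$; write $\gamma_{TZF}$ for the resulting SINR. Fix a threshold $z>0$, and let $F(\rho_1)=\Pr(\gamma_{TZF}<z)$ be the outage probability. Then, as $\rho_1\to\infty$, $F(\rho_1)\sim A(\rho_1)$ (that is, $F(\rho_1)/A(\rho_1)\to1$), where $$A(\rho_1)=\begin{cases} \left(\frac{1}{\Gamma(M_R+1)}+\frac{1}{\Gamma(M_T-1)\Gamma(M_R)}\sum\limits_{k=0}^{\infty}\frac{(-1)^{k+1}}{k!\,(k+M_T-1)}\left(\frac{d_2^{\tau}}{\kappa}\right)^{M_T+k-1}\frac{1}{M_R-M_T-k+1}\right)\left(\frac{d_1^{\tau}z}{\rho_1}\right)^{M_R}, & M_T>M_R+1,\\[2mm] \frac{1}{\Gamma(M_R+1)}\left(1+\frac{1}{\Gamma(M_R)}\left(\ln\rho_1-\ln(d_1^{\tau}z)+\psi(1)\right)\left(\frac{d_2^{\tau}}{\kappa}\right)^{M_R}\right)\left(\frac{d_1^{\tau}z}{\rho_1}\right)^{M_R}, & M_T=M_R+1,\\[2mm]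 \frac{\Gamma(M_R-M_T+1)}{\Gamma(M_T)\Gamma(M_R)}\left(\frac{d_2^{\tau}}{\kappa}\right)^{M_T-1}\left(\frac{d_1^{\tau}z}{\rho_1}\right)^{M_T-1}, & M_T<M_R+1, \end{cases}$$ $\psi$ is the digamma function, and the series in the first case converges. Consequently the diversity order is $\min(M_R,M_T-1)$: $$\lim_{\rho_1\to\infty}\frac{-\ln F(\rho_1)}{\ln\rho_1}=\min(M_R,M_T-1).$$ -/

import Mathlib

open MeasureTheory ProbabilityTheory Filter Topology Asymptotics
open scoped NNReal Matrix

noncomputable section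

/-- Euclidean norm of a complex vector. -/
def l2norm {n : ℕ} (v : Fin n → ℂ) : ℝ :=
  ‖(WithLp.toLp 2 v : EuclideanSpace ℂ (Fin n))‖

/-- The circularly symmetric complex Gaussian law `CN(0, v)`: independent real and imaginary
parts, each real Gaussian with mean `0` and variance `v / 2`. -/
def complexGaussian (v : ℝ≥0) : Measure ℂ :=
  ((gaussianReal 0 (v / 2)).prod (gaussianReal 0 (v / 2))).map
    (fun p : ℝ × ℝ => (p.1 : ℂ) + (p.2 : ℂ) * Complex.I)

/-- All the scalar channel coefficients, as one family of random variables. -/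
def channelCoeff {Ω : Type*} {MR MT : ℕ} (hSR : Ω → Fin MR → ℂ)
    (HRR : Ω → Matrix (Fin MR) (Fin MT) ℂ) (hRD : Ω → Fin MT → ℂ) :
    Fin MR ⊕ (Fin MR × Fin MT) ⊕ Fin MT → Ω → ℂ :=
  Sum.elim (fun i ω => hSR ω i)
    (Sum.elim (fun p ω => HRR ω p.1 p.2) (fun j ω => hRD ω j))

/-- Rayleigh fading: all channel coefficients are independent, those of the source-relay and
relay-destination channels are `CN(0, 1)`, those of the loopback interference channel are
`CN(0, σ2)`. -/
structure IsRayleighFading {Ω : Type*} [MeasurableSpace Ω] (P : Measure Ω) {MR MT : ℕ}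
    (σ2 : ℝ≥0) (hSR : Ω → Fin MR → ℂ) (HRR : Ω → Matrix (Fin MR) (Fin MT) ℂ)
    (hRD : Ω → Fin MT → ℂ) : Prop where
  law_SR : ∀ i, HasLaw (fun ω => hSR ω i) (complexGaussian 1) P
  law_RR : ∀ i j, HasLaw (fun ω => HRR ω i j) (complexGaussian σ2) P
  law_RD : ∀ j, HasLaw (fun ω => hRD ω j) (complexGaussian 1) P
  indep : iIndepFun (channelCoeff hSR HRR hRD) P

/-- `κ = η α / (1 - α)`. -/
def harvestFactor (η α : ℝ) : ℝ := η * α / (1 - α)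

/-- End-to-end signal-to-interference-plus-noise ratio of the full-duplex decode-and-forward
energy-harvesting relay with source power `PS`, combining vector `wr`, beamforming vector `wt`. -/
def endToEndSINR {MR MT : ℕ} (PS κ d₁ d₂ τ : ℝ) (hSR : Fin MR → ℂ)
    (HRR : Matrix (Fin MR) (Fin MT) ℂ) (hRD : Fin MT → ℂ)
    (wr : Fin MR → ℂ) (wt : Fin MT → ℂ) : ℝ :=
  min (PS * ‖wr ⬝ᵥ hSR‖ ^ 2 /
        (κ * PS * l2norm hSR ^ 2 * ‖wr ⬝ᵥ (HRR *ᵥ wt)‖ ^ 2 + d₁ ^ τ))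
    (κ * PS / (d₁ ^ τ * d₂ ^ τ) * l2norm hSR ^ 2 * ‖hRD ⬝ᵥ wt‖ ^ 2)

/-- The maximum ratio combining vector `hSR† / ‖hSR‖`. -/
def mrcCombiner {MR : ℕ} (hSR : Fin MR → ℂ) : Fin MR → ℂ :=
  fun i => star (hSR i) / (l2norm hSR : ℂ)

/-- `wt` is a transmit zero-forcing beamforming vector: it maximizes `|hRD wt|²` subject to
`‖wt‖ = 1` and `hSR† HRR wt = 0`. -/
def IsTransmitZF {MR MT : ℕ} (hSR : Fin MR → ℂ) (HRR : Matrix (Fin MR) (Fin MT) ℂ)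
    (hRD : Fin MT → ℂ) (wt : Fin MT → ℂ) : Prop :=
  (l2norm wt = 1 ∧ star hSR ⬝ᵥ (HRR *ᵥ wt) = 0) ∧
    ∀ w : Fin MT → ℂ, l2norm w = 1 → star hSR ⬝ᵥ (HRR *ᵥ w) = 0 →
      ‖hRD ⬝ᵥ w‖ ^ 2 ≤ ‖hRD ⬝ᵥ wt‖ ^ 2

/-- Outage probability of the transmit zero-forcing scheme at threshold `z`, when the first-hop
SNR (the source power) is `ρ₁`. -/
def outageTZF {Ω : Type*} [MeasurableSpace Ω] (P : Measure Ω) {MR MT : ℕ} (η α d₁ d₂ τ : ℝ)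
    (hSR : Ω → Fin MR → ℂ) (HRR : Ω → Matrix (Fin MR) (Fin MT) ℂ) (hRD : Ω → Fin MT → ℂ)
    (wt : Ω → Fin MT → ℂ) (z ρ₁ : ℝ) : ℝ :=
  P.real {ω | endToEndSINR ρ₁ (harvestFactor η α) d₁ d₂ τ (hSR ω) (HRR ω) (hRD ω)
    (mrcCombiner (hSR ω)) (wt ω) < z}

/-- The `k`-th term of the series in the case `MR + 1 < MT`, with `c = d₂ ^ τ / κ`. -/
def tzfSeriesTerm (MR MT : ℕ) (c : ℝ) (k : ℕ) : ℝ :=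
  (-1 : ℝ) ^ (k + 1) / ((k.factorial : ℝ) * ((k : ℝ) + (MT : ℝ) - 1)) * c ^ (MT + k - 1) *
    (1 / ((MR : ℝ) - (MT : ℝ) - (k : ℝ) + 1))

/-- The three-case high-SNR expression for the outage probability. The value `ψ(1)` of the
digamma function is real; in the case `MR + 1 < MT` the index `k = MR - MT + 1` is negative, so
no term of the series has to be left out. -/
def tzfAsymptotic (MR MT : ℕ) (κ d₁ d₂ τ z ρ₁ : ℝ) : ℝ :=
  if MR + 1 < MT then
    (1 / Real.Gamma ((MR : ℝ) + 1) +
      1 / (Real.Gamma ((MT : ℝ) - 1) * Real.Gamma MR) *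
        ∑' k : ℕ, tzfSeriesTerm MR MT (d₂ ^ τ / κ) k) * (d₁ ^ τ * z / ρ₁) ^ MR
  else if MT = MR + 1 then
    1 / Real.Gamma ((MR : ℝ) + 1) *
      (1 + 1 / Real.Gamma MR *
        (Real.log ρ₁ - Real.log (d₁ ^ τ * z) + (Complex.digamma 1).re) * (d₂ ^ τ / κ) ^ MR) *
      (d₁ ^ τ * z / ρ₁) ^ MR
  else
    Real.Gamma ((MR : ℝ) - (MT : ℝ) + 1) / (Real.Gamma MT * Real.Gamma MR) *
      (d₂ ^ τ / κ) ^ (MT - 1) * (d₁ ^ τ * z / ρ₁) ^ (MT - 1)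

end

/-! Maximum ratio combining gives the first hop the gain `X = ‖hSR‖²`, and zero forcing removes the
interference. The best admissible beamformer gives the second hop the gain `Y`, the squared norm of
the projection of `hRD` onto the orthogonal complement of one vector `u` built from `hSR` and `HRR`
(`IsTransmitZF.gain_eq`). Hence the SINR is `(ρ₁ / d₁ ^ τ) * X * min 1 (Y / c)` with `c = d₂ ^ τ /
κ`.

`X` has the gamma law of shape `m = MR`. Given `hSR` and `HRR`, the vector `u` is almost surely
nonzero and `hRD` is an isotropic Gaussian vector, so `Y` has the gamma law of shape `n = MT - 1`
whatever `u` is. Thus `X` and `Y` are independent (`IsRayleighFading.hasLaw_gains`), and the outage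
probability is `P(X * min 1 (Y / c) < ε)` with `ε = d₁ ^ τ * z / ρ₁ → 0`.

A gamma variable of shape `m` lies below `t` with probability equivalent to `t ^ m / m!`. If `m <
n`, conditioning on `Y` gives `ε ^ m * E[max 1 (c / Y) ^ m] / m!`, and expanding `exp (-y)` on `(0,
c]` turns the expectation into the series. If `n < m`, conditioning on `X` gives `(c * ε) ^ n / n! *
E[X ^ (-n)]`. If `m = n`, that inverse moment diverges logarithmically; its cutoff at `ε` produces
the factor `-log ε`, and constants added to this logarithm do not affect the equivalence. -/

/-! ### Characteristic function of the gamma law -/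

lemma integrableOn_pow_mul_exp_neg (k : ℕ) :
    IntegrableOn (fun x : ℝ => x ^ k * Real.exp (-x)) (Set.Ioi 0) := by
  refine (Real.GammaIntegral_convergent (s := k + 1) (by positivity)).congr_fun
    (fun x _ => ?_) measurableSet_Ioi
  simp [mul_comm]

lemma integrableOn_pow_mul_cexp (t : ℝ) (k : ℕ) :
    IntegrableOn (fun x : ℝ => (x : ℂ) ^ k * Complex.exp (-((1 - t * Complex.I) * x)))
      (Set.Ioi 0) := by
  refine (integrableOn_pow_mul_exp_neg k).mono' (by fun_prop) ?_
  filter_upwards [self_mem_ae_restrict measurableSet_Ioi] with x hx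
  rw [norm_mul, norm_pow, Complex.norm_real, Complex.norm_exp, Real.norm_of_nonneg hx.le]
  simp

/-- Integration by parts, by induction on `k`. The exponent `r = 1 - it` has real part 1, so the
boundary terms at infinity vanish. -/
lemma integral_pow_mul_cexp (t : ℝ) (k : ℕ) :
    ∫ x in Set.Ioi (0 : ℝ), (x : ℂ) ^ k * Complex.exp (-((1 - t * Complex.I) * x)) =
      k.factorial * (1 / (1 - t * Complex.I)) ^ (k + 1) := by
  set r : ℂ := 1 - t * Complex.I with hr
  have hr1 : r.re = 1 := by simp [hr]
  have hr0 : r ≠ 0 := fun h => by simp [h] at hr1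
  have hd (x : ℝ) : HasDerivAt (fun x : ℝ => Complex.exp (-(r * x)))
      (-(r * Complex.exp (-(r * x)))) x := by
    have := ((Complex.ofRealCLM.hasDerivAt (x := x)).const_mul r).neg.cexp
    simpa [mul_comm] using this
  have hlim (k : ℕ) : Tendsto (fun x : ℝ => (x : ℂ) ^ k * Complex.exp (-(r * x))) atTop (𝓝 0) := by
    rw [tendsto_zero_iff_norm_tendsto_zero]
    refine (Real.tendsto_pow_mul_exp_neg_atTop_nhds_zero k).congr' ?_
    filter_upwards [eventually_ge_atTop 0] with x hx
    rw [norm_mul, norm_pow, Complex.norm_real, Complex.norm_exp, Real.norm_of_nonneg hx]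
    simp [hr1]
  induction k with
  | zero =>
    have hint := integrableOn_pow_mul_cexp t 0
    have := integral_Ioi_of_hasDerivAt_of_tendsto' (a := 0) (m := 0)
      (fun x _ => (hd x).const_mul (-r⁻¹)) (f' := fun x => (-r⁻¹) * (-(r * Complex.exp (-(r * x)))))
      (by
        refine hint.congr_fun (fun x _ => ?_) measurableSet_Ioi
        simp [field])
      (by simpa using (hlim 0).const_mul (-r⁻¹))
    simp only [pow_zero, one_mul]
    rw [← integral_congr_ae (ae_of_all _ fun x => ?_), this]
    · simp
    · simp [field]
  | succ k ih =>
    have hi1 := integrableOn_pow_mul_cexp t k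
    have hi2 := integrableOn_pow_mul_cexp t (k + 1)
    have := integral_Ioi_of_hasDerivAt_of_tendsto' (a := 0) (m := 0)
      (f := fun x : ℝ => (x : ℂ) ^ (k + 1) * Complex.exp (-(r * x)))
      (f' := fun x : ℝ => ((k : ℂ) + 1) * ((x : ℂ) ^ k * Complex.exp (-(r * x))) -
        r * ((x : ℂ) ^ (k + 1) * Complex.exp (-(r * x))))
      (fun x _ => by
        have h := ((Complex.ofRealCLM.hasDerivAt (x := x)).pow (k + 1)).mul (hd x)
        refine h.congr_deriv ?_
        simp
        ring)
      ((hi1.const_mul _).sub (hi2.const_mul _)) (hlim (k + 1))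
    rw [integral_sub (hi1.const_mul _) (hi2.const_mul _), integral_const_mul, integral_const_mul,
      ih] at this
    simp only [Complex.ofReal_zero, ne_eq, Nat.succ_ne_zero, not_false_eq_true, zero_pow, zero_mul,
      sub_zero] at this
    rw [sub_eq_zero] at this
    apply mul_left_cancel₀ hr0
    rw [← this, Nat.factorial_succ]
    push_cast
    rw [one_div, pow_succ _ (k + 1)]
    field_simp

lemma gamma_natCast_of_one_le {m : ℕ} (hm : 1 ≤ m) : Real.Gamma m = (m - 1).factorial := by
  obtain ⟨k, rfl⟩ : ∃ k, m = k + 1 := ⟨m - 1, by omega⟩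
  push_cast
  rw [Real.Gamma_nat_eq_factorial]

lemma integral_gammaMeasure {E : Type*} [NormedAddCommGroup E] [NormedSpace ℝ E] {m : ℕ}
    (hm : 1 ≤ m) (f : ℝ → E) :
    ∫ x, f x ∂(gammaMeasure m 1) =
      ∫ x in Set.Ioi (0 : ℝ), (x ^ (m - 1) * Real.exp (-x) / (m - 1).factorial) • f x := by
  have hm0 : (0 : ℝ) < m := by exact_mod_cast hm
  rw [gammaMeasure,
    integral_withDensity_eq_integral_toReal_smul (by unfold gammaPDF; fun_prop)
      (by simp [gammaPDF]), ← integral_indicator measurableSet_Ioi]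
  apply integral_congr_ae
  -- `gammaPDF` need not vanish at 0 (shape 1), while the indicator of the open half-line does.
  filter_upwards [compl_mem_ae_iff.2 (measure_singleton (0 : ℝ))] with x hx
  by_cases hx0 : 0 < x
  · rw [Set.indicator_of_mem (by exact hx0), gammaPDF_of_nonneg hx0.le,
      ENNReal.toReal_ofReal (by positivity), gamma_natCast_of_one_le hm,
      show (m : ℝ) - 1 = (m - 1 : ℕ) by push_cast [hm]; ring, Real.rpow_natCast]
    congr 1
    simp [field]
  · have : x < 0 := lt_of_le_of_ne (not_lt.1 hx0) hx
    rw [Set.indicator_of_notMem (by exact hx0), gammaPDF_of_neg this]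
    simp

lemma charFun_gammaMeasure {m : ℕ} (hm : 1 ≤ m) (t : ℝ) :
    charFun (gammaMeasure m 1) t = (1 / (1 - t * Complex.I)) ^ m := by
  rw [charFun_apply_real, integral_gammaMeasure hm]
  have h0 : ∀ x : ℝ, (x ^ (m - 1) * Real.exp (-x) / (m - 1).factorial) •
      Complex.exp (t * x * Complex.I) = ((m - 1).factorial : ℂ)⁻¹ *
        ((x : ℂ) ^ (m - 1) * Complex.exp (-((1 - t * Complex.I) * x))) := by
    intro x
    rw [Complex.real_smul, sub_mul, neg_sub, Complex.exp_sub, mul_right_comm (t : ℂ), one_mul]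
    push_cast
    rw [Complex.exp_neg]
    field_simp
  simp_rw [h0]
  rw [integral_const_mul, integral_pow_mul_cexp, Nat.sub_add_cancel hm, inv_mul_cancel_left₀]
  exact_mod_cast (m - 1).factorial_ne_zero

/-! ### Norms and projections of Gaussian vectors -/

/-- A single factor is a complex square root; squaring avoids the choice of a branch. Only even real
dimensions occur below. -/
lemma integral_exp_sq_gaussianReal (t : ℝ) :
    (∫ x : ℝ, Complex.exp (t * (x ^ 2 / 2 : ℝ) * Complex.I) ∂(gaussianReal 0 1)) ^ 2 =
      1 / (1 - t * Complex.I) := by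
  rw [integral_gaussianReal_eq_integral_smul one_ne_zero]
  have h0 : ∀ x : ℝ, gaussianPDFReal 0 1 x • Complex.exp (t * (x ^ 2 / 2 : ℝ) * Complex.I) =
      (√(2 * Real.pi) : ℂ)⁻¹ * Complex.exp (-((1 - t * Complex.I) / 2) * (x : ℂ) ^ 2) := by
    intro x
    rw [gaussianPDFReal, Complex.real_smul]
    push_cast
    rw [mul_assoc, ← Complex.exp_add]
    congr 2
    · simp
    · simp
      ring
  simp_rw [h0]
  rw [integral_const_mul, integral_gaussian_complex (by simp), mul_pow, ← Complex.cpow_nat_mul,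
    inv_pow, ← Complex.ofReal_pow, Real.sq_sqrt (by positivity)]
  have : (1 - t * Complex.I) ≠ 0 := fun h => by simpa using congrArg Complex.re h
  have hpi : (Real.pi : ℂ) ≠ 0 := by exact_mod_cast Real.pi_ne_zero
  push_cast
  norm_num
  field_simp

/-- In an orthonormal basis the squared norm is a sum of `2 * m` independent squares, so the
characteristic function is the `m`-th power of that of a pair. -/
lemma map_norm_sq_stdGaussian {E : Type*} [NormedAddCommGroup E] [InnerProductSpace ℝ E]
    [FiniteDimensional ℝ E] [MeasurableSpace E] [BorelSpace E] {m : ℕ} (hm : 1 ≤ m)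
    (hE : Module.finrank ℝ E = 2 * m) :
    (stdGaussian E).map (fun x => ‖x‖ ^ 2 / 2) = gammaMeasure m 1 := by
  have hm0 : (0 : ℝ) < m := by exact_mod_cast hm
  have := isProbabilityMeasure_gammaMeasure hm0 one_pos
  have : IsProbabilityMeasure ((stdGaussian E).map (fun x => ‖x‖ ^ 2 / 2)) :=
    Measure.isProbabilityMeasure_map (by fun_prop)
  apply Measure.ext_of_charFun
  ext t
  rw [charFun_gammaMeasure hm, charFun_apply_real, integral_map (by fun_prop) (by fun_prop),
    stdGaussian, integral_map (Measurable.aemeasurable (by fun_prop)) (by fun_prop)]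
  have h1 (x : Fin (Module.finrank ℝ E) → ℝ) :
      Complex.exp (t * ((‖∑ i, x i • stdOrthonormalBasis ℝ E i‖ ^ 2 / 2 : ℝ) : ℂ) * Complex.I) =
      ∏ i, Complex.exp (t * (x i ^ 2 / 2 : ℝ) * Complex.I) := by
    rw [← Complex.exp_sum, ← (stdOrthonormalBasis ℝ E).sum_sq_inner_right]
    simp only [(stdOrthonormalBasis ℝ E).orthonormal.inner_right_fintype]
    push_cast
    rw [Finset.sum_div, Finset.mul_sum, Finset.sum_mul]
  simp_rw [h1]
  rw [integral_fintype_prod_eq_prod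
    (f := fun _ (x : ℝ) => Complex.exp (t * (x ^ 2 / 2 : ℝ) * Complex.I))]
  rw [Finset.prod_const, Finset.card_univ, Fintype.card_fin, hE, pow_mul,
    integral_exp_sq_gaussianReal]

lemma map_orthogonalProjection_stdGaussian {E : Type*} [NormedAddCommGroup E]
    [InnerProductSpace ℝ E] [FiniteDimensional ℝ E] [MeasurableSpace E] [BorelSpace E]
    (W : Submodule ℝ E) :
    (stdGaussian E).map W.orthogonalProjectionOnto = stdGaussian W := by
  have : IsProbabilityMeasure ((stdGaussian E).map W.orthogonalProjectionOnto) :=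
    Measure.isProbabilityMeasure_map (by fun_prop)
  apply Measure.ext_of_charFun
  ext t
  rw [charFun_stdGaussian, charFun_apply, integral_map (by fun_prop) (by fun_prop)]
  simp_rw [Submodule.inner_orthogonalProjectionOnto_eq_of_mem_right]
  rw [← charFun_apply, charFun_stdGaussian]
  simp

lemma charFun_complexGaussian_one (w : ℂ) :
    charFun (complexGaussian 1) w = Complex.exp (-(‖w‖ ^ 2 / 4 : ℝ)) := by
  rw [charFun_apply, complexGaussian, integral_map (by fun_prop) (by fun_prop)]
  have h1 (p : ℝ × ℝ) : Complex.exp ((inner ℝ ((p.1 : ℂ) + p.2 * Complex.I) w : ℝ) * Complex.I) =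
      Complex.exp (w.re * p.1 * Complex.I) * Complex.exp (w.im * p.2 * Complex.I) := by
    rw [← Complex.exp_add, Complex.inner]
    simp
    ring_nf
  simp_rw [h1]
  rw [integral_prod_mul (fun x : ℝ => Complex.exp (w.re * x * Complex.I))
    (fun x : ℝ => Complex.exp (w.im * x * Complex.I)), ← charFun_apply_real, ← charFun_apply_real,
    charFun_gaussianReal, charFun_gaussianReal, ← Complex.exp_add, Complex.sq_norm,
    Complex.normSq_apply]
  push_cast
  congr 1
  ring

instance isProbabilityMeasure_complexGaussian (v : ℝ≥0) :
    IsProbabilityMeasure (complexGaussian v) :=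
  Measure.isProbabilityMeasure_map (by fun_prop)

/-- Real and imaginary parts have variance 1/2, whence the scaling; it supplies the factor 1/2 in
`map_norm_sq_stdGaussian`. -/
lemma map_toLp_pi_complexGaussian_one (k : ℕ) :
    (Measure.pi (fun _ : Fin k => complexGaussian 1)).map (WithLp.toLp 2) =
      (stdGaussian (EuclideanSpace ℂ (Fin k))).map (fun x => (√2)⁻¹ • x) := by
  have : IsProbabilityMeasure
      ((stdGaussian (EuclideanSpace ℂ (Fin k))).map (fun x => (√2)⁻¹ • x)) :=
    Measure.isProbabilityMeasure_map (by fun_prop)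
  have : IsProbabilityMeasure ((Measure.pi (fun _ : Fin k => complexGaussian 1)).map
      (WithLp.toLp 2 : _ → EuclideanSpace ℂ (Fin k))) :=
    Measure.isProbabilityMeasure_map (by fun_prop)
  apply Measure.ext_of_charFun (E := EuclideanSpace ℂ (Fin k))
  ext t
  rw [charFun_map_smul, charFun_stdGaussian, charFun_pi]
  simp_rw [charFun_complexGaussian_one]
  have h2 : ‖(√2)⁻¹‖ ^ 2 = (1 / 2 : ℝ) := by
    rw [Real.norm_eq_abs, sq_abs, inv_pow, Real.sq_sqrt (by norm_num)]
    norm_num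
  rw [← Complex.exp_sum, norm_smul, ← Complex.ofReal_pow, mul_pow, h2, EuclideanSpace.norm_sq_eq]
  push_cast
  rw [Finset.sum_neg_distrib, ← Finset.sum_div]
  congr 1
  ring

lemma map_norm_sq_orthogonalProjection_pi {k m : ℕ} (hm : 1 ≤ m)
    (W : Submodule ℝ (EuclideanSpace ℂ (Fin k))) (hW : Module.finrank ℝ W = 2 * m) :
    (Measure.pi (fun _ : Fin k => complexGaussian 1)).map
      (fun g => ‖W.orthogonalProjectionOnto (WithLp.toLp 2 g)‖ ^ 2) = gammaMeasure m 1 := by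
  rw [← map_norm_sq_stdGaussian (E := W) hm hW, ← map_orthogonalProjection_stdGaussian W,
    Measure.map_map (by fun_prop) (by fun_prop)]
  have h1 : (fun g : Fin k → ℂ => ‖W.orthogonalProjectionOnto (WithLp.toLp 2 g)‖ ^ 2) =
    (fun x => ‖W.orthogonalProjectionOnto x‖ ^ 2) ∘ WithLp.toLp 2 := rfl
  rw [h1, ← Measure.map_map (by fun_prop) (by fun_prop), map_toLp_pi_complexGaussian_one,
    Measure.map_map (by fun_prop) (by fun_prop)]
  congr 1
  ext x
  simp [norm_smul, mul_pow]
  ring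

/-! ### The zero-forcing gain as a squared projection -/

lemma l2norm_nonneg {n : ℕ} (v : Fin n → ℂ) : 0 ≤ l2norm v := norm_nonneg _

lemma l2norm_sq {n : ℕ} (v : Fin n → ℂ) : l2norm v ^ 2 = ∑ i, ‖v i‖ ^ 2 :=
  EuclideanSpace.norm_sq_eq _

@[fun_prop]
lemma measurable_l2norm {n : ℕ} : Measurable (l2norm : (Fin n → ℂ) → ℝ) := by
  unfold l2norm
  fun_prop

lemma l2norm_star {n : ℕ} (v : Fin n → ℂ) : l2norm (star v) = l2norm v := by
  rw [← sq_eq_sq₀ (l2norm_nonneg _) (l2norm_nonneg _), l2norm_sq, l2norm_sq]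
  simp

lemma inner_toLp {n : ℕ} (u v : Fin n → ℂ) :
    inner ℂ (WithLp.toLp 2 u : EuclideanSpace ℂ (Fin n)) (WithLp.toLp 2 v) = star u ⬝ᵥ v := by
  rw [PiLp.inner_apply, dotProduct]
  simp [mul_comm]

lemma inner_real_eq_re {n : ℕ} (x y : EuclideanSpace ℂ (Fin n)) :
    inner ℝ x y = (inner ℂ x y).re := by
  rw [PiLp.inner_apply, PiLp.inner_apply]
  simp

/-- The orthogonal complement of a complex vector, as a real subspace. -/
noncomputable def nullSpace {k : ℕ} (u : Fin k → ℂ) : Submodule ℝ (EuclideanSpace ℂ (Fin k)) :=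
  (LinearMap.ker (innerSL ℂ (WithLp.toLp 2 u : EuclideanSpace ℂ (Fin k))).toLinearMap).restrictScalars ℝ

lemma mem_nullSpace {k : ℕ} (u : Fin k → ℂ) (x : EuclideanSpace ℂ (Fin k)) :
    x ∈ nullSpace u ↔ inner ℂ (WithLp.toLp 2 u) x = 0 := by
  simp [nullSpace]

lemma finrank_nullSpace {n : ℕ} {u : Fin (n + 1) → ℂ} (hu : u ≠ 0) :
    Module.finrank ℝ (nullSpace u) = 2 * n := by
  set f := (innerSL ℂ (WithLp.toLp 2 u : EuclideanSpace ℂ (Fin (n + 1)))).toLinearMap with hf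
  have hf0 : f ≠ 0 := by
    intro h
    have := LinearMap.congr_fun h (WithLp.toLp 2 u)
    simp [hf] at this
    exact hu this
  have h1 : Module.finrank ℂ (LinearMap.ker f) = n := by
    have := Module.Dual.finrank_ker_add_one_of_ne_zero hf0
    rw [finrank_euclideanSpace_fin] at this
    omega
  have h2 := finrank_real_of_complex (LinearMap.ker f)
  rw [h1] at h2
  exact h2

/-- The squared norm of the projection of `g` on the orthogonal complement of `u`. -/
noncomputable def zfGain {k : ℕ} (u g : Fin k → ℂ) : ℝ :=
  l2norm g ^ 2 - ‖star u ⬝ᵥ g‖ ^ 2 / l2norm u ^ 2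

lemma Measurable.zfGain {α : Type*} [MeasurableSpace α] {k : ℕ} {u g : α → Fin k → ℂ}
    (hu : Measurable u) (hg : Measurable g) : Measurable fun x => zfGain (u x) (g x) := by
  unfold _root_.zfGain dotProduct
  fun_prop

/-- The residual of `g` after projection on `u`, which realises `zfGain u g`. -/
lemma exists_residual {k : ℕ} (u g : Fin k → ℂ) :
    ∃ r : EuclideanSpace ℂ (Fin k), inner ℂ (WithLp.toLp 2 u) r = 0 ∧
      (∀ v : EuclideanSpace ℂ (Fin k), inner ℂ (WithLp.toLp 2 u) v = 0 →
        inner ℂ v (WithLp.toLp 2 g) = inner ℂ v r) ∧ ‖r‖ ^ 2 = zfGain u g := by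
  set U : EuclideanSpace ℂ (Fin k) := WithLp.toLp 2 u with hU
  set G : EuclideanSpace ℂ (Fin k) := WithLp.toLp 2 g with hG
  set c : ℂ := inner ℂ U G / (‖U‖ : ℂ) ^ 2 with hc
  have hUr : inner ℂ U (G - c • U) = 0 := by
    rw [inner_sub_right, inner_smul_right, inner_self_eq_norm_sq_to_K]
    by_cases h0 : U = 0
    · simp [h0]
    · have : (‖U‖ : ℂ) ≠ 0 := by simpa using h0
      simp [hc, field]
  have hpyth : ‖G‖ ^ 2 = ‖G - c • U‖ ^ 2 + ‖c • U‖ ^ 2 := by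
    have h : inner ℂ (G - c • U) (c • U) = 0 := by
      rw [inner_smul_right, ← inner_conj_symm, hUr]
      simp
    have := norm_add_sq_eq_norm_sq_add_norm_sq_of_inner_eq_zero _ _ h
    rw [sub_add_cancel] at this
    simpa [sq] using this
  refine ⟨G - c • U, hUr, fun v hv => ?_, ?_⟩
  · rw [inner_sub_right, inner_smul_right, ← inner_conj_symm v U, hv]
    simp
  · rw [zfGain, ← inner_toLp]
    change _ = ‖G‖ ^ 2 - ‖inner ℂ U G‖ ^ 2 / ‖U‖ ^ 2
    rw [hpyth, norm_smul, hc, norm_div]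
    by_cases h0 : U = 0
    · simp [h0]
    · have : ‖U‖ ≠ 0 := by simpa using h0
      simp [field]

lemma norm_sq_projection_nullSpace {k : ℕ} (u g : Fin k → ℂ) :
    ‖(nullSpace u).orthogonalProjectionOnto (WithLp.toLp 2 g)‖ ^ 2 = zfGain u g := by
  obtain ⟨r, hr, hv, hnorm⟩ := exists_residual u g
  have hproj : (nullSpace u).starProjection (WithLp.toLp 2 g) = r := by
    refine Submodule.eq_starProjection_of_mem_of_inner_eq_zero ((mem_nullSpace u _).2 hr) ?_
    intro w hw
    rw [real_inner_comm, inner_real_eq_re, inner_sub_right, hv w ((mem_nullSpace u _).1 hw)]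
    simp
  rw [← hnorm, ← hproj]
  rfl

lemma inner_toLp_star_eq_zero_iff {k : ℕ} (u w : Fin k → ℂ) :
    inner ℂ (WithLp.toLp 2 u) (WithLp.toLp 2 (star w) : EuclideanSpace ℂ (Fin k)) = 0 ↔
      u ⬝ᵥ w = 0 := by
  rw [inner_toLp, Matrix.star_dotProduct, star_star, star_eq_zero, dotProduct_comm]

/-- The objective pairs `star w` with the residual `r` of `g`, so Cauchy–Schwarz bounds it by
`‖r‖²`; the conjugate of `r / ‖r‖` is admissible and attains the bound. -/
lemma IsTransmitZF.gain_eq {MR MT : ℕ} {h : Fin MR → ℂ} {H : Matrix (Fin MR) (Fin MT) ℂ}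
    {g w : Fin MT → ℂ} (hw : IsTransmitZF h H g w) :
    ‖g ⬝ᵥ w‖ ^ 2 = zfGain (star h ᵥ* H) g := by
  obtain ⟨⟨hw1, hw0⟩, hmax⟩ := hw
  obtain ⟨r, hr, hv, hnorm⟩ := exists_residual (star h ᵥ* H) g
  have hobj (w : Fin MT → ℂ) : g ⬝ᵥ w = inner ℂ
      (WithLp.toLp 2 (star w) : EuclideanSpace ℂ (Fin MT)) (WithLp.toLp 2 g) := by
    rw [inner_toLp, star_star, dotProduct_comm]
  rw [← hnorm]
  apply le_antisymm
  · rw [Matrix.dotProduct_mulVec, ← inner_toLp_star_eq_zero_iff] at hw0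
    rw [hobj, hv _ hw0]
    have := norm_inner_le_norm (𝕜 := ℂ)
      (WithLp.toLp 2 (star w) : EuclideanSpace ℂ (Fin MT)) r
    change _ ≤ l2norm (star w) * _ at this
    rw [l2norm_star, hw1, one_mul] at this
    gcongr
  · by_cases hr0 : r = 0
    · rw [hr0, norm_zero, zero_pow two_ne_zero]
      positivity
    have hrn : ‖r‖ ≠ 0 := by simpa using hr0
    set v : EuclideanSpace ℂ (Fin MT) := ((‖r‖ : ℂ)⁻¹) • r with hvdef
    have hv0 : inner ℂ (WithLp.toLp 2 (star h ᵥ* H)) v = 0 := by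
      rw [hvdef, inner_smul_right, hr, mul_zero]
    have hvstar : (WithLp.toLp 2 (star (star v.ofLp)) : EuclideanSpace ℂ (Fin MT)) = v := by
      rw [star_star]
    have h1 := hmax (star v.ofLp) (by
      rw [l2norm_star]
      change ‖v‖ = 1
      rw [hvdef, norm_smul, norm_inv, Complex.norm_real, norm_norm, inv_mul_cancel₀ hrn]) (by
      rw [Matrix.dotProduct_mulVec, ← inner_toLp_star_eq_zero_iff, hvstar, hv0])
    refine le_trans (le_of_eq ?_) h1
    rw [hobj, hvstar, hv _ hv0, hvdef, inner_smul_left, inner_self_eq_norm_sq_to_K]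
    simp [field]

lemma map_zfGain {n : ℕ} (hn : 1 ≤ n) {u : Fin (n + 1) → ℂ} (hu : u ≠ 0) :
    (Measure.pi (fun _ : Fin (n + 1) => complexGaussian 1)).map (zfGain u) = gammaMeasure n 1 := by
  rw [← map_norm_sq_orthogonalProjection_pi hn _ (finrank_nullSpace hu)]
  congr 1
  ext g
  rw [norm_sq_projection_nullSpace]

lemma map_l2norm_sq {m : ℕ} (hm : 1 ≤ m) :
    (Measure.pi (fun _ : Fin m => complexGaussian 1)).map (fun h => l2norm h ^ 2) =
      gammaMeasure m 1 := by
  -- For `u = 0` the complement is the whole space, and division by zero makes `zfGain 0 g` the full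
  -- squared norm.
  rw [← map_norm_sq_orthogonalProjection_pi hm (nullSpace (0 : Fin m → ℂ))]
  · congr 1
    ext g
    rw [norm_sq_projection_nullSpace]
    simp [zfGain]
  · have : nullSpace (0 : Fin m → ℂ) = ⊤ := by
      ext x
      simp [mem_nullSpace]
    rw [this, finrank_top, finrank_real_of_complex, finrank_euclideanSpace_fin]

/-! ### The nulled direction is almost surely nonzero -/

lemma nullSingletonClass_complexGaussian {v : ℝ≥0} (hv : v ≠ 0) :
    NullSingletonClass (complexGaussian v) := by
  have := nullSingletonClass_gaussianReal (μ := 0) (v := v / 2) (by simpa using hv)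
  refine ⟨fun z => ?_⟩
  rw [complexGaussian, Measure.map_apply (by fun_prop) (measurableSet_singleton z)]
  refine measure_mono_null (t := {z.re} ×ˢ Set.univ) ?_ ?_
  · rintro ⟨x, y⟩ hxy
    have := congrArg Complex.re (Set.mem_singleton_iff.1 hxy)
    simpa using this
  · rw [Measure.prod_prod]
    simp

/-- With all coordinates but `i₀` frozen, the sum vanishes for a single value of `x i₀`, which is a
null event. -/
lemma ae_sum_mul_ne_zero {ι : Type*} [Fintype ι] {μ : ι → Measure ℂ}
    [∀ i, IsProbabilityMeasure (μ i)] [∀ i, NullSingletonClass (μ i)] {a : ι → ℂ} {i₀ : ι}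
    (ha : a i₀ ≠ 0) : ∀ᵐ x ∂Measure.pi μ, ∑ i, a i * x i ≠ 0 := by
  classical
  have hind := (iIndepFun_pi (μ := μ) (X := fun i x => a i * x)
    (fun i => by fun_prop)).indepFun_finsetSum_of_notMem (fun i => by fun_prop)
    (Finset.notMem_erase i₀ Finset.univ)
  have hmeas : Measurable (fun x : ι → ℂ => ∑ i ∈ Finset.univ.erase i₀, a i * x i) := by fun_prop
  rw [indepFun_iff_map_prod_eq_prod_map_map
    (by rw [Finset.sum_fn]; exact hmeas.aemeasurable)
    (Measurable.aemeasurable (by fun_prop))] at hind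
  set ν := (Measure.pi μ).map (∑ j ∈ Finset.univ.erase i₀, fun x : ι → ℂ => a j * x j)
  have hnull : (ν.prod ((Measure.pi μ).map fun x => a i₀ * x i₀)) {p | p.1 + p.2 = 0} = 0 := by
    have hms : MeasurableSet {p : ℂ × ℂ | p.1 + p.2 = 0} :=
      measurableSet_eq_fun (by fun_prop) (by fun_prop)
    rw [Measure.measure_prod_null hms]
    refine ae_of_all _ fun y => ?_
    beta_reduce
    rw [Measure.map_apply (f := fun x : ι → ℂ => a i₀ * x i₀) (by fun_prop)
      (measurable_prodMk_left hms)]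
    have : (fun x : ι → ℂ => a i₀ * x i₀) ⁻¹' (Prod.mk y ⁻¹' {p | p.1 + p.2 = 0}) =
        (fun x : ι → ℂ => x i₀) ⁻¹' ({-y / a i₀} : Set ℂ) := by
      ext x
      simp only [Set.mem_preimage, Set.mem_ofPred_eq, Set.mem_singleton_iff]
      rw [eq_div_iff ha, eq_neg_iff_add_eq_zero, add_comm, mul_comm]
    rw [this]
    exact Measure.pi_eval_preimage_null _ (measure_singleton _)
  rw [← hind] at hnull
  have h3 := ae_of_ae_map (Measurable.aemeasurable (by
    rw [Finset.sum_fn]; fun_prop)) (compl_mem_ae_iff.2 hnull)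
  filter_upwards [h3] with x hx h0
  apply hx
  simp only [Finset.sum_apply]
  rw [Finset.sum_erase_add _ _ (Finset.mem_univ i₀), h0]

lemma ae_vecMul_ne_zero {m k : ℕ} (hm : 1 ≤ m) (hk : 1 ≤ k) {σ2 : ℝ≥0} (hσ2 : σ2 ≠ 0) :
    ∀ᵐ p ∂((Measure.pi fun _ : Fin m => complexGaussian 1).prod
      (Measure.pi fun _ : Fin m × Fin k => complexGaussian σ2)),
      star p.1 ᵥ* (Matrix.of fun i j => p.2 (i, j)) ≠ 0 := by
  have h1 := nullSingletonClass_complexGaussian (one_ne_zero : (1 : ℝ≥0) ≠ 0)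
  have h2 := nullSingletonClass_complexGaussian hσ2
  let i₀ : Fin m := ⟨0, hm⟩
  let j₀ : Fin k := ⟨0, hk⟩
  have hmeas : MeasurableSet {p : (Fin m → ℂ) × (Fin m × Fin k → ℂ) |
      ∑ i, star (p.1 i) * p.2 (i, j₀) ≠ 0} := by
    refine (measurableSet_eq_fun ?_ measurable_const).compl
    fun_prop
  have key : ∀ᵐ p ∂((Measure.pi fun _ : Fin m => complexGaussian 1).prod
      (Measure.pi fun _ : Fin m × Fin k => complexGaussian σ2)),
      ∑ i, star (p.1 i) * p.2 (i, j₀) ≠ 0 := by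
    rw [Measure.ae_prod_iff_ae_ae hmeas]
    -- One nonzero entry of `h` suffices: column `j₀` of the matrix then gives a nondegenerate
    -- linear form.
    filter_upwards [Measure.ae_eval_ne (μ := fun _ : Fin m => complexGaussian 1) i₀ 0] with h hh
    have := ae_sum_mul_ne_zero (μ := fun _ : Fin m × Fin k => complexGaussian σ2)
      (a := fun q => if q.2 = j₀ then star (h q.1) else 0) (i₀ := (i₀, j₀)) (by simpa using hh)
    filter_upwards [this] with H hH
    simpa [Fintype.sum_prod_type, ite_mul] using hH
  filter_upwards [key] with p hp h0
  exact hp (congrFun h0 j₀)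


/-! ### Joint law of the two gains -/

lemma HasLaw.sum_pi {Ω ι κ : Type*} [MeasurableSpace Ω] {P : Measure Ω} [Fintype ι] [Fintype κ]
    {E : Type*} [MeasurableSpace E] {μ : ι → Measure E} {ν : κ → Measure E}
    [∀ i, SigmaFinite (μ i)] [∀ i, SigmaFinite (ν i)] {X : ι → Ω → E} {Y : κ → Ω → E}
    (h : HasLaw (fun ω i => Sum.elim X Y i ω) (Measure.pi (Sum.elim μ ν)) P) :
    HasLaw (fun ω => ((fun i => X i ω), (fun i => Y i ω)))
      ((Measure.pi μ).prod (Measure.pi ν)) P := by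
  have : ∀ i, SigmaFinite (Sum.elim μ ν i) := by
    rintro (i | i) <;> simp only [Sum.elim_inl, Sum.elim_inr] <;> infer_instance
  exact (measurePreserving_sumPiEquivProdPi (X := fun _ => E) (Sum.elim μ ν)).comp_hasLaw h

lemma IsRayleighFading.hasLaw_channels {Ω : Type*} [MeasurableSpace Ω] {P : Measure Ω}
    [IsProbabilityMeasure P] {m k : ℕ} {σ2 : ℝ≥0}
    {hSR : Ω → Fin m → ℂ} {HRR : Ω → Matrix (Fin m) (Fin k) ℂ} {hRD : Ω → Fin k → ℂ}
    (hf : IsRayleighFading P σ2 hSR HRR hRD) :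
    HasLaw (fun ω => ((hSR ω, fun p : Fin m × Fin k => HRR ω p.1 p.2), hRD ω))
      (((Measure.pi fun _ : Fin m => complexGaussian 1).prod
        (Measure.pi fun _ : Fin m × Fin k => complexGaussian σ2)).prod
          (Measure.pi fun _ : Fin k => complexGaussian 1)) P := by
  have hlaw : HasLaw (fun ω i => channelCoeff hSR HRR hRD i ω)
      (Measure.pi (Sum.elim (fun _ => complexGaussian 1)
        (Sum.elim (fun _ => complexGaussian σ2) (fun _ => complexGaussian 1)))) P := by
    refine iIndepFun.hasLaw_pi ?_ hf.indep
    rintro (i | ⟨i, j⟩ | i)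
    exacts [hf.law_SR i, hf.law_RR i j, hf.law_RD i]
  have : ∀ i, IsProbabilityMeasure (Sum.elim (fun _ : Fin m × Fin k => complexGaussian σ2)
      (fun _ : Fin k => complexGaussian 1) i) := by
    rintro (i | i) <;> exact isProbabilityMeasure_complexGaussian _
  have h1 := HasLaw.sum_pi hlaw
  have h2 := ((MeasurePreserving.id (Measure.pi fun _ : Fin m => complexGaussian 1)).prod
    (measurePreserving_sumPiEquivProdPi (X := fun _ => ℂ)
      (Sum.elim (fun _ : Fin m × Fin k => complexGaussian σ2)
        (fun _ : Fin k => complexGaussian 1)))).comp_hasLaw h1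
  exact (measurePreserving_prodAssoc _ _ _).symm.comp_hasLaw h2

/-- Under Rayleigh fading the first-hop gain and the zero-forcing gain of the second hop are
independent with gamma laws. -/
lemma IsRayleighFading.hasLaw_gains {Ω : Type*} [MeasurableSpace Ω] {P : Measure Ω}
    [IsProbabilityMeasure P] {m n : ℕ} (hm : 1 ≤ m) (hn : 1 ≤ n) {σ2 : ℝ≥0} (hσ2 : σ2 ≠ 0)
    {hSR : Ω → Fin m → ℂ} {HRR : Ω → Matrix (Fin m) (Fin (n + 1)) ℂ} {hRD : Ω → Fin (n + 1) → ℂ}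
    (hf : IsRayleighFading P σ2 hSR HRR hRD) :
    HasLaw (fun ω => (l2norm (hSR ω) ^ 2, zfGain (star (hSR ω) ᵥ* HRR ω) (hRD ω)))
      ((gammaMeasure m 1).prod (gammaMeasure n 1)) P := by
  have hf' : MeasurePreserving
      (fun p : (Fin m → ℂ) × (Fin m × Fin (n + 1) → ℂ) => l2norm p.1 ^ 2)
      ((Measure.pi fun _ : Fin m => complexGaussian 1).prod
        (Measure.pi fun _ : Fin m × Fin (n + 1) => complexGaussian σ2)) (gammaMeasure m 1) :=
    (⟨by fun_prop, map_l2norm_sq hm⟩ : MeasurePreserving (fun h => l2norm h ^ 2)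
      (Measure.pi fun _ : Fin m => complexGaussian 1) _).comp measurePreserving_fst
  have hu : Measurable fun q : ((Fin m → ℂ) × (Fin m × Fin (n + 1) → ℂ)) × (Fin (n + 1) → ℂ) =>
      star q.1.1 ᵥ* (Matrix.of fun i j => q.1.2 (i, j)) := by
    unfold Matrix.vecMul dotProduct
    simp only [Pi.star_apply, Matrix.of_apply]
    fun_prop
  have hg : Measurable (Function.uncurry fun (p : (Fin m → ℂ) × (Fin m × Fin (n + 1) → ℂ))
      (g : Fin (n + 1) → ℂ) => zfGain (star p.1 ᵥ* (Matrix.of fun i j => p.2 (i, j))) g) :=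
    Measurable.zfGain hu measurable_snd
  -- The conditional law of the second gain is the same for almost every `p`, so the image measure
  -- is a product: this is the independence.
  have hskew := hf'.skew_product (μc := Measure.pi fun _ : Fin (n + 1) => complexGaussian 1) hg
    (μd := gammaMeasure n 1) (by
      filter_upwards [ae_vecMul_ne_zero hm (Nat.le_add_left 1 n) hσ2] with p hp
      exact map_zfGain hn hp)
  exact (hskew.comp_hasLaw hf.hasLaw_channels).congr (ae_of_all _ fun ω => rfl)

/-- The probability that `X * min 1 (Y / c) < ε` for independent gamma variables `X`, `Y` of
shapes `m`, `n`. -/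
noncomputable def gammaOutage (m n : ℕ) (c ε : ℝ) : ℝ :=
  ((gammaMeasure m 1).prod (gammaMeasure n 1)).real {p | p.1 * min 1 (p.2 / c) < ε}

lemma measurableSet_gammaOutage (c ε : ℝ) :
    MeasurableSet {p : ℝ × ℝ | p.1 * min 1 (p.2 / c) < ε} :=
  measurableSet_lt (by fun_prop) measurable_const

/-! ### Reduction of the outage event to two gamma variables -/

lemma mrcCombiner_dotProduct {m : ℕ} (h : Fin m → ℂ) : mrcCombiner h ⬝ᵥ h = l2norm h := by
  have h1 : mrcCombiner h ⬝ᵥ h = (∑ i, (‖h i‖ : ℂ) ^ 2) / l2norm h := by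
    rw [dotProduct, Finset.sum_div]
    refine Finset.sum_congr rfl fun i _ => ?_
    rw [mrcCombiner, div_mul_eq_mul_div, ← Complex.conj_mul', Complex.star_def]
  have h2 : (∑ i, (‖h i‖ : ℂ) ^ 2) = (l2norm h : ℂ) ^ 2 := by
    rw [← Complex.ofReal_pow, l2norm_sq]
    push_cast
    rfl
  rw [h1, h2, sq, mul_self_div_self]

lemma mrcCombiner_dotProduct_eq_zero {m : ℕ} {h v : Fin m → ℂ} (hv : star h ⬝ᵥ v = 0) :
    mrcCombiner h ⬝ᵥ v = 0 := by
  have : mrcCombiner h = (l2norm h : ℂ)⁻¹ • star h := by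
    ext i
    simp [mrcCombiner, div_eq_inv_mul]
  rw [this, smul_dotProduct, hv, smul_zero]

lemma endToEndSINR_lt_iff {m k : ℕ} {ρ κ d₁ d₂ τ z : ℝ} (hρ : 0 < ρ) (hκ : 0 < κ) (hd₁ : 0 < d₁)
    (hd₂ : 0 < d₂) {h : Fin m → ℂ} {H : Matrix (Fin m) (Fin k) ℂ} {g w : Fin k → ℂ}
    (hw : IsTransmitZF h H g w) :
    endToEndSINR ρ κ d₁ d₂ τ h H g (mrcCombiner h) w < z ↔
      l2norm h ^ 2 * min 1 (zfGain (star h ᵥ* H) g / (d₂ ^ τ / κ)) < d₁ ^ τ * z / ρ := by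
  have h1 : 0 < d₁ ^ τ := Real.rpow_pos_of_pos hd₁ τ
  have h2 : 0 < d₂ ^ τ := Real.rpow_pos_of_pos hd₂ τ
  have heq : endToEndSINR ρ κ d₁ d₂ τ h H g (mrcCombiner h) w =
      ρ / d₁ ^ τ * (l2norm h ^ 2 * min 1 (zfGain (star h ᵥ* H) g / (d₂ ^ τ / κ))) := by
    rw [endToEndSINR, hw.gain_eq, mrcCombiner_dotProduct,
      mrcCombiner_dotProduct_eq_zero hw.1.2, Complex.norm_real, Real.norm_eq_abs, sq_abs,
      norm_zero, mul_min_of_nonneg _ _ (sq_nonneg _), mul_min_of_nonneg _ _ (by positivity)]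
    congr 1
    · rw [zero_pow two_ne_zero, mul_zero, zero_add]
      ring
    · field_simp
  rw [heq, lt_div_iff₀ hρ, div_mul_eq_mul_div, div_lt_iff₀ h1]
  constructor <;> intro h <;> linarith

lemma outageTZF_eq_gammaOutage {Ω : Type*} [MeasurableSpace Ω] {P : Measure Ω}
    [IsProbabilityMeasure P] {m n : ℕ} (hm : 1 ≤ m) (hn : 1 ≤ n) {η α d₁ d₂ τ z ρ : ℝ} {σ2 : ℝ≥0}
    (hκ : 0 < harvestFactor η α) (hd₁ : 0 < d₁) (hd₂ : 0 < d₂) (hσ2 : σ2 ≠ 0)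
    {hSR : Ω → Fin m → ℂ} {HRR : Ω → Matrix (Fin m) (Fin (n + 1)) ℂ} {hRD : Ω → Fin (n + 1) → ℂ}
    (hf : IsRayleighFading P σ2 hSR HRR hRD) {wt : Ω → Fin (n + 1) → ℂ}
    (hwt : ∀ᵐ ω ∂P, IsTransmitZF (hSR ω) (HRR ω) (hRD ω) (wt ω)) (hρ : 0 < ρ) :
    outageTZF P η α d₁ d₂ τ hSR HRR hRD wt z ρ =
      gammaOutage m n (d₂ ^ τ / harvestFactor η α) (d₁ ^ τ * z / ρ) := by
  rw [gammaOutage, ← (hf.hasLaw_gains hm hn hσ2).measureReal_eq (measurableSet_gammaOutage _ _)]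
  -- The outage event agrees almost everywhere with a measurable event in the gains, so
  -- measurability of `wt` plays no role.
  apply measureReal_congr
  filter_upwards [hwt] with ω hω
  exact propext (endToEndSINR_lt_iff hρ hκ hd₁ hd₂ hω)

/-! ### Gamma law near zero and its inverse moments -/

lemma isProbabilityMeasure_gammaMeasure_natCast {m : ℕ} (hm : 1 ≤ m) :
    IsProbabilityMeasure (gammaMeasure m 1) :=
  isProbabilityMeasure_gammaMeasure (by exact_mod_cast hm) one_pos

lemma ae_pos_gammaMeasure {m : ℕ} : ∀ᵐ x ∂(gammaMeasure m 1), 0 < x := by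
  have hpdf : Measurable (gammaPDF m 1) := by unfold gammaPDF; fun_prop
  rw [gammaMeasure, ae_withDensity_iff hpdf]
  filter_upwards [compl_mem_ae_iff.2 (measure_singleton (0 : ℝ))] with x hx h
  by_contra h0
  exact h (gammaPDF_of_neg (lt_of_le_of_ne (not_lt.1 h0) hx))

lemma integrable_gammaMeasure_of_integrableOn {m : ℕ} (hm : 1 ≤ m) {f : ℝ → ℝ}
    (hf : IntegrableOn (fun x => (x ^ (m - 1) * Real.exp (-x) / (m - 1).factorial) * f x)
      (Set.Ioi 0)) : Integrable f (gammaMeasure m 1) := by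
  have hpdf : Measurable (gammaPDF m 1) := by unfold gammaPDF; fun_prop
  have hm0 : (0 : ℝ) < m := by exact_mod_cast hm
  rw [gammaMeasure, integrable_withDensity_iff_integrable_smul' hpdf (by simp [gammaPDF])]
  rw [← integrable_indicator_iff measurableSet_Ioi] at hf
  refine hf.congr ?_
  filter_upwards [compl_mem_ae_iff.2 (measure_singleton (0 : ℝ))] with x hx
  by_cases hx0 : 0 < x
  · rw [Set.indicator_of_mem (by exact hx0), gammaPDF_of_nonneg hx0.le,
      ENNReal.toReal_ofReal (by positivity), gamma_natCast_of_one_le hm,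
      show (m : ℝ) - 1 = (m - 1 : ℕ) by push_cast [hm]; ring, Real.rpow_natCast, smul_eq_mul]
    congr 1
    simp [field]
  · have : x < 0 := lt_of_le_of_ne (not_lt.1 hx0) hx
    rw [Set.indicator_of_notMem (by exact hx0), gammaPDF_of_neg this]
    simp

lemma gammaMeasure_real_Iio {m : ℕ} (hm : 1 ≤ m) {t : ℝ} (ht : 0 ≤ t) :
    (gammaMeasure m 1).real (Set.Iio t) =
      ∫ x in (0)..t, x ^ (m - 1) * Real.exp (-x) / (m - 1).factorial := by
  rw [← integral_indicator_one measurableSet_Iio, integral_gammaMeasure hm,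
    intervalIntegral.integral_of_le ht, integral_Ioc_eq_integral_Ioo, ← Set.Ioi_inter_Iio,
    ← setIntegral_indicator measurableSet_Iio]
  refine integral_congr_ae (ae_of_all _ fun x => ?_)
  by_cases hx : x < t
  · simp [Set.indicator, hx]
  · simp [Set.indicator, hx]

lemma integral_pow_div_factorial {m : ℕ} (hm : 1 ≤ m) (t : ℝ) :
    ∫ x in (0)..t, x ^ (m - 1) / (m - 1).factorial = t ^ m / m.factorial := by
  obtain ⟨k, rfl⟩ : ∃ k, m = k + 1 := ⟨m - 1, by omega⟩
  simp only [Nat.add_sub_cancel]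
  rw [intervalIntegral.integral_div, integral_pow, Nat.factorial_succ]
  push_cast
  simp
  field_simp

lemma gammaMeasure_real_Iio_le {m : ℕ} (hm : 1 ≤ m) {t : ℝ} (ht : 0 ≤ t) :
    (gammaMeasure m 1).real (Set.Iio t) ≤ t ^ m / m.factorial := by
  rw [gammaMeasure_real_Iio hm ht, ← integral_pow_div_factorial hm]
  refine intervalIntegral.integral_mono_on ht (Continuous.intervalIntegrable (by fun_prop) _ _)
    (Continuous.intervalIntegrable (by fun_prop) _ _) fun x hx => ?_
  have : Real.exp (-x) ≤ 1 := Real.exp_le_one_iff.2 (by linarith [hx.1])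
  have h0 := pow_nonneg hx.1 (m - 1)
  gcongr
  nlinarith

/-- On `[0, t]` the factor `exp (-x)` lies between `exp (-t)` and 1. Both bounds are needed
uniformly in `t`, not only in the limit. -/
lemma le_gammaMeasure_real_Iio {m : ℕ} (hm : 1 ≤ m) {t : ℝ} (ht : 0 ≤ t) :
    Real.exp (-t) * (t ^ m / m.factorial) ≤ (gammaMeasure m 1).real (Set.Iio t) := by
  rw [gammaMeasure_real_Iio hm ht, ← integral_pow_div_factorial hm,
    ← intervalIntegral.integral_const_mul]
  refine intervalIntegral.integral_mono_on ht (Continuous.intervalIntegrable (by fun_prop) _ _)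
    (Continuous.intervalIntegrable (by fun_prop) _ _) fun x hx => ?_
  have : Real.exp (-t) ≤ Real.exp (-x) := Real.exp_le_exp.2 (by linarith [hx.2])
  have h0 := pow_nonneg hx.1 (m - 1)
  rw [mul_div_assoc', mul_comm]
  gcongr

lemma tendsto_gammaMeasure_real_Iio {m : ℕ} (hm : 1 ≤ m) {s : ℝ} (hs : 0 ≤ s) :
    Tendsto (fun ε => (gammaMeasure m 1).real (Set.Iio (ε * s)) / ε ^ m) (𝓝[>] 0)
      (𝓝 (s ^ m / m.factorial)) := by
  have h1 : Tendsto (fun ε : ℝ => Real.exp (-(ε * s)) * (s ^ m / m.factorial)) (𝓝[>] 0)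
      (𝓝 (s ^ m / m.factorial)) := by
    have : Tendsto (fun ε : ℝ => Real.exp (-(ε * s)) * (s ^ m / m.factorial)) (𝓝 0)
      (𝓝 (Real.exp (-(0 * s)) * (s ^ m / m.factorial))) := Continuous.tendsto (by fun_prop) 0
    simp only [zero_mul, neg_zero, Real.exp_zero, one_mul] at this
    exact this.mono_left nhdsWithin_le_nhds
  refine tendsto_of_tendsto_of_tendsto_of_le_of_le' h1 tendsto_const_nhds ?_ ?_
  · filter_upwards [self_mem_nhdsWithin] with ε hε
    have hε0 : 0 < ε := hε
    rw [le_div_iff₀ (by positivity)]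
    refine le_trans (le_of_eq ?_) (le_gammaMeasure_real_Iio hm (by positivity))
    rw [mul_pow]
    ring
  · filter_upwards [self_mem_nhdsWithin] with ε hε
    have hε0 : 0 < ε := hε
    rw [div_le_iff₀ (by positivity)]
    refine le_trans (gammaMeasure_real_Iio_le hm (by positivity)) (le_of_eq ?_)
    rw [mul_pow]
    ring

lemma integral_pow_mul_exp_neg (k : ℕ) :
    ∫ x in Set.Ioi (0 : ℝ), x ^ k * Real.exp (-x) = k.factorial := by
  rw [← Real.Gamma_nat_eq_factorial, Real.Gamma_eq_integral (by positivity)]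
  refine setIntegral_congr_fun measurableSet_Ioi fun x _ => ?_
  simp [mul_comm]

/-- On the positive axis an inverse power lowers the shape of the gamma density. -/
lemma gammaWeight_mul_inv_pow {m n : ℕ} (h : n < m) {x : ℝ} (hx : 0 < x) :
    (x ^ (m - 1) * Real.exp (-x) / (m - 1).factorial) * (x ^ n)⁻¹ =
      ((m - 1).factorial : ℝ)⁻¹ * (x ^ (m - n - 1) * Real.exp (-x)) := by
  have : x ^ (m - 1) = x ^ (m - n - 1) * x ^ n := by rw [← pow_add]; congr 1; omega
  rw [this]
  field_simp

lemma integrable_inv_pow_gammaMeasure {m n : ℕ} (h : n < m) :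
    Integrable (fun x => (x ^ n)⁻¹) (gammaMeasure m 1) := by
  refine integrable_gammaMeasure_of_integrableOn (by omega) ?_
  exact IntegrableOn.congr_fun ((integrableOn_pow_mul_exp_neg (m - n - 1)).const_mul _)
    (fun x hx => (gammaWeight_mul_inv_pow h hx).symm) measurableSet_Ioi

lemma integral_inv_pow_gammaMeasure {m n : ℕ} (h : n < m) :
    ∫ x, (x ^ n)⁻¹ ∂(gammaMeasure m 1) = (m - n - 1).factorial / (m - 1).factorial := by
  rw [integral_gammaMeasure (by omega)]
  simp_rw [smul_eq_mul]
  rw [setIntegral_congr_fun measurableSet_Ioi fun x hx => gammaWeight_mul_inv_pow h hx,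
    integral_const_mul, integral_pow_mul_exp_neg]
  ring

/-! ### Outage asymptotics for unequal shapes -/

lemma gammaOutage_eq_integral_right {m n : ℕ} (hm : 1 ≤ m) (hn : 1 ≤ n) {c ε : ℝ} (hc : 0 < c) :
    gammaOutage m n c ε =
      ∫ y, (gammaMeasure m 1).real (Set.Iio (ε * max 1 (c / y))) ∂(gammaMeasure n 1) := by
  have := isProbabilityMeasure_gammaMeasure_natCast hm
  have := isProbabilityMeasure_gammaMeasure_natCast hn
  have hms := measurableSet_gammaOutage c ε
  rw [gammaOutage, measureReal_def, Measure.prod_apply_symm hms,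
    ← integral_toReal (measurable_measure_prodMk_right hms).aemeasurable
      (ae_of_all _ fun y => measure_lt_top _ _)]
  refine integral_congr_ae ?_
  filter_upwards [ae_pos_gammaMeasure] with y hy
  rw [← measureReal_def]
  congr 1
  ext x
  have h1 : min 1 (y / c) = (max 1 (c / y))⁻¹ := by
    rcases le_total y c with h | h
    · rw [min_eq_right ((div_le_one hc).2 h), max_eq_right ((one_le_div hy).2 h), inv_div]
    · rw [min_eq_left ((one_le_div hc).2 h), max_eq_left ((div_le_one hy).2 h), inv_one]
  simp only [Set.mem_preimage, Set.mem_ofPred_eq, Set.mem_Iio]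
  rw [h1, ← div_eq_mul_inv, div_lt_iff₀ (by positivity)]

/-- Conditioning on the first gain `x`: below `ε` outage is certain, otherwise only the second hop
can cause it. -/
lemma gammaOutage_eq_integral_left {m n : ℕ} (hm : 1 ≤ m) (hn : 1 ≤ n) {c ε : ℝ} (hc : 0 < c) :
    gammaOutage m n c ε =
      ∫ x, (if x < ε then 1 else (gammaMeasure n 1).real (Set.Iio (ε * (c / x))))
        ∂(gammaMeasure m 1) := by
  have := isProbabilityMeasure_gammaMeasure_natCast hm
  have := isProbabilityMeasure_gammaMeasure_natCast hn
  have hms := measurableSet_gammaOutage c ε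
  rw [gammaOutage, measureReal_def, Measure.prod_apply hms,
    ← integral_toReal (measurable_measure_prodMk_left hms).aemeasurable
      (ae_of_all _ fun y => measure_lt_top _ _)]
  refine integral_congr_ae ?_
  filter_upwards [ae_pos_gammaMeasure] with x hx
  rw [← measureReal_def]
  split_ifs with h
  · have : Prod.mk x ⁻¹' {p : ℝ × ℝ | p.1 * min 1 (p.2 / c) < ε} = Set.univ := by
      ext y
      simp only [Set.mem_preimage, Set.mem_ofPred_eq, Set.mem_univ, iff_true]
      exact lt_of_le_of_lt (mul_le_of_le_one_right hx.le (min_le_left _ _)) h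
    rw [this, probReal_univ]
  · congr 1
    ext y
    simp only [Set.mem_preimage, Set.mem_ofPred_eq, Set.mem_Iio]
    rw [mul_min_of_nonneg _ _ hx.le, mul_one, min_lt_iff, or_iff_right h, mul_div_assoc',
      mul_div_assoc', div_lt_iff₀ hc, lt_div_iff₀ hx, mul_comm x]

lemma measurable_gammaMeasure_real_Iio (m : ℕ) (hm : 1 ≤ m) :
    Measurable fun t => (gammaMeasure m 1).real (Set.Iio t) := by
  have := isProbabilityMeasure_gammaMeasure_natCast hm
  exact Monotone.measurable fun s t h => measureReal_mono (Set.Iio_subset_Iio h)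

lemma integrable_max_pow_gammaMeasure {m n : ℕ} (h : m < n) {c : ℝ} (hc : 0 < c) :
    Integrable (fun y => max 1 (c / y) ^ m / m.factorial) (gammaMeasure n 1) := by
  have := isProbabilityMeasure_gammaMeasure_natCast (m := n) (by omega)
  have h1 : Integrable (fun y : ℝ => (1 + c ^ m * (y ^ m)⁻¹) / m.factorial)
      (gammaMeasure n 1) :=
    ((integrable_const 1).add ((integrable_inv_pow_gammaMeasure h).const_mul _)).div_const _
  refine h1.mono' (Measurable.aestronglyMeasurable (by fun_prop)) ?_
  filter_upwards [ae_pos_gammaMeasure] with y hy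
  rw [Real.norm_of_nonneg (by positivity)]
  gcongr
  rcases le_total 1 (c / y) with h | h
  · rw [max_eq_right h, div_pow, div_eq_mul_inv]
    linarith
  · rw [max_eq_left h, one_pow]
    have : 0 ≤ c ^ m * (y ^ m)⁻¹ := by positivity
    linarith

/-- Outage when the first hop is the bottleneck. -/
lemma tendsto_gammaOutage_of_lt {m n : ℕ} (hm : 1 ≤ m) (h : m < n) {c : ℝ} (hc : 0 < c) :
    Tendsto (fun ε => gammaOutage m n c ε / ε ^ m) (𝓝[>] 0)
      (𝓝 (∫ y, max 1 (c / y) ^ m / m.factorial ∂(gammaMeasure n 1))) := by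
  have hn : 1 ≤ n := by omega
  have := isProbabilityMeasure_gammaMeasure_natCast hn
  have hG := measurable_gammaMeasure_real_Iio m hm
  simp_rw [gammaOutage_eq_integral_right hm hn hc, ← integral_div]
  refine tendsto_integral_filter_of_dominated_convergence
    (fun y => max 1 (c / y) ^ m / m.factorial) ?_ ?_ ?_ ?_
  · refine Eventually.of_forall fun ε => Measurable.aestronglyMeasurable ?_
    exact (hG.comp (by fun_prop)).div_const _
  · filter_upwards [self_mem_nhdsWithin] with ε hε
    have hε0 : 0 < ε := hε
    refine ae_of_all _ fun y => ?_
    rw [Real.norm_of_nonneg (by positivity), div_le_iff₀ (by positivity)]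
    refine le_trans (gammaMeasure_real_Iio_le hm (by positivity)) (le_of_eq ?_)
    rw [mul_pow]
    ring
  · exact integrable_max_pow_gammaMeasure h hc
  · exact ae_of_all _ fun y => tendsto_gammaMeasure_real_Iio hm (by positivity)

/-- Outage when the second hop is the bottleneck. -/
lemma tendsto_gammaOutage_of_gt {m n : ℕ} (hn : 1 ≤ n) (h : n < m) {c : ℝ} (hc : 0 < c) :
    Tendsto (fun ε => gammaOutage m n c ε / ε ^ n) (𝓝[>] 0)
      (𝓝 (c ^ n / n.factorial * ((m - n - 1).factorial / (m - 1).factorial))) := by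
  have hm : 1 ≤ m := by omega
  have := isProbabilityMeasure_gammaMeasure_natCast hm
  have hG := measurable_gammaMeasure_real_Iio n hn
  simp_rw [gammaOutage_eq_integral_left hm hn hc, ← integral_div]
  rw [← integral_inv_pow_gammaMeasure h, ← integral_const_mul]
  refine tendsto_integral_filter_of_dominated_convergence
    -- The 1 covers the branch `x < ε`, where `1 / ε ^ n ≤ 1 / x ^ n`; the other term covers `x ≥
    -- ε`. For fixed `x > 0` the first branch eventually disappears.
    (fun x => (1 + c ^ n / n.factorial) * (x ^ n)⁻¹) ?_ ?_ ?_ ?_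
  · refine Eventually.of_forall fun ε => Measurable.aestronglyMeasurable ?_
    refine (Measurable.ite measurableSet_Iio measurable_const (hG.comp (by fun_prop))).div_const _
  · filter_upwards [self_mem_nhdsWithin] with ε hε
    have hε0 : 0 < ε := hε
    filter_upwards [ae_pos_gammaMeasure] with x hx
    split_ifs with hxε
    · rw [Real.norm_of_nonneg (by positivity), one_div]
      calc (ε ^ n)⁻¹ ≤ (x ^ n)⁻¹ := by gcongr
        _ ≤ _ := le_mul_of_one_le_left (by positivity) (le_add_of_nonneg_right (by positivity))
    · rw [Real.norm_of_nonneg (by positivity), div_le_iff₀ (by positivity)]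
      refine le_trans (gammaMeasure_real_Iio_le hn (by positivity)) ?_
      have : (ε * (c / x)) ^ n / n.factorial = c ^ n / n.factorial * (x ^ n)⁻¹ * ε ^ n := by
        rw [mul_pow, div_pow]
        ring
      rw [this, add_mul, add_mul]
      exact le_add_of_nonneg_left (by positivity)
  · exact (integrable_inv_pow_gammaMeasure h).const_mul _
  · filter_upwards [ae_pos_gammaMeasure] with x hx
    have h1 := tendsto_gammaMeasure_real_Iio hn (s := c / x) (by positivity)
    have h2 : (c / x) ^ n / n.factorial = c ^ n / n.factorial * (x ^ n)⁻¹ := by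
      rw [div_pow]
      ring
    rw [h2] at h1
    refine h1.congr' ?_
    filter_upwards [nhdsWithin_le_nhds (Iio_mem_nhds hx)] with ε hε
    rw [if_neg (not_lt.2 (le_of_lt hε))]

/-! ### Outage asymptotics for equal shapes -/

lemma setIntegral_gammaMeasure {m : ℕ} (hm : 1 ≤ m) {S : Set ℝ} (hS : MeasurableSet S)
    (hS0 : S ⊆ Set.Ioi 0) (g : ℝ → ℝ) :
    ∫ x in S, g x ∂(gammaMeasure m 1) =
      ∫ x in S, (x ^ (m - 1) * Real.exp (-x) / (m - 1).factorial) * g x := by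
  rw [← integral_indicator hS, integral_gammaMeasure hm]
  simp_rw [smul_eq_mul, ← Set.indicator_mul_right S
    (fun x : ℝ => x ^ (m - 1) * Real.exp (-x) / (m - 1).factorial) g]
  rw [setIntegral_indicator hS, Set.inter_eq_self_of_subset_right hS0]

lemma gammaWeight_mul_inv_pow_self {m : ℕ} (hm : 1 ≤ m) {x : ℝ} (hx : 0 < x) :
    (x ^ (m - 1) * Real.exp (-x) / (m - 1).factorial) * (x ^ m)⁻¹ =
      ((m - 1).factorial : ℝ)⁻¹ * (x⁻¹ * Real.exp (-x)) := by
  have : x ^ m = x ^ (m - 1) * x := by rw [← pow_succ]; congr 1; omega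
  rw [this]
  field_simp

lemma setIntegral_inv_mul_exp_neg_le {ε : ℝ} (hε : 0 < ε) (hε1 : ε ≤ 1) :
    ∫ x in Set.Ioi ε, x⁻¹ * Real.exp (-x) ≤ -Real.log ε + 1 := by
  have h1 : IntegrableOn (fun x : ℝ => x⁻¹) (Set.Ioc ε 1) := by
    have := intervalIntegral.intervalIntegrable_inv (f := fun x : ℝ => x) (μ := volume) (a := ε)
      (b := 1) (fun x hx => by
        rw [Set.uIcc_of_le hε1] at hx
        exact (hε.trans_le hx.1).ne') continuousOn_id
    rwa [intervalIntegrable_iff_integrableOn_Ioc_of_le hε1] at this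
  have h2 : IntegrableOn (fun x : ℝ => Real.exp (-x)) (Set.Ioi 1) := integrableOn_exp_neg_Ioi 1
  have h1' : IntegrableOn (fun x : ℝ => x⁻¹ * Real.exp (-x)) (Set.Ioc ε 1) := by
    refine h1.mono' (Measurable.aestronglyMeasurable (by fun_prop)) ?_
    filter_upwards [self_mem_ae_restrict measurableSet_Ioc] with x hx
    have hx0 : 0 < x := hε.trans hx.1
    rw [Real.norm_of_nonneg (by positivity)]
    exact mul_le_of_le_one_right (by positivity) (Real.exp_le_one_iff.2 (by linarith))
  have h2' : IntegrableOn (fun x : ℝ => x⁻¹ * Real.exp (-x)) (Set.Ioi 1) := by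
    refine h2.mono' (Measurable.aestronglyMeasurable (by fun_prop)) ?_
    filter_upwards [self_mem_ae_restrict measurableSet_Ioi] with x hx
    have hx1 : 1 < x := hx
    rw [Real.norm_of_nonneg (by positivity)]
    exact mul_le_of_le_one_left (by positivity) (inv_le_one_of_one_le₀ hx1.le)
  rw [← Set.Ioc_union_Ioi_eq_Ioi hε1, setIntegral_union (Set.Ioc_disjoint_Ioi le_rfl)
    measurableSet_Ioi h1' h2']
  refine add_le_add ?_ ?_
  · calc ∫ x in Set.Ioc ε 1, x⁻¹ * Real.exp (-x) ≤ ∫ x in Set.Ioc ε 1, x⁻¹ := by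
          refine setIntegral_mono_on h1' h1 measurableSet_Ioc fun x hx => ?_
          have hx0 : 0 < x := hε.trans hx.1
          exact mul_le_of_le_one_right (by positivity) (Real.exp_le_one_iff.2 (by linarith))
      _ = -Real.log ε := by
          rw [← intervalIntegral.integral_of_le hε1, integral_inv_of_pos hε one_pos, one_div,
            Real.log_inv]
  · calc ∫ x in Set.Ioi 1, x⁻¹ * Real.exp (-x) ≤ ∫ x in Set.Ioi (1 : ℝ), Real.exp (-x) := by
          refine setIntegral_mono_on h2' h2 measurableSet_Ioi fun x hx => ?_
          have hx1 : 1 < x := hx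
          exact mul_le_of_le_one_left (by positivity) (inv_le_one_of_one_le₀ hx1.le)
      _ ≤ 1 := by
          rw [integral_exp_neg_Ioi]
          exact Real.exp_le_one_iff.2 (by norm_num)

lemma gammaOutage_self_le {m : ℕ} (hm : 1 ≤ m) {c ε : ℝ} (hc : 0 < c) (hε : 0 < ε) (hε1 : ε ≤ 1) :
    gammaOutage m m c ε ≤
      ε ^ m * (1 / m.factorial + c ^ m / (m.factorial * (m - 1).factorial) *
        (-Real.log ε + 1)) := by
  have := isProbabilityMeasure_gammaMeasure_natCast hm
  have hG := measurable_gammaMeasure_real_Iio m hm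
  rw [gammaOutage_eq_integral_left hm hm hc]
  set A : ℝ := (c * ε) ^ m / m.factorial with hA
  have hA0 : 0 ≤ A := by positivity
  have hi1 : Integrable (Set.indicator (Set.Iio ε) (1 : ℝ → ℝ)) (gammaMeasure m 1) :=
    (integrable_const (1 : ℝ)).indicator measurableSet_Iio
  have hi2 : Integrable (Set.indicator (Set.Ioi ε) (fun x : ℝ => A * (x ^ m)⁻¹))
      (gammaMeasure m 1) := by
    refine Integrable.of_bound (Measurable.aestronglyMeasurable
      (Measurable.indicator (by fun_prop) measurableSet_Ioi)) (A * (ε ^ m)⁻¹) (ae_of_all _ ?_)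
    intro x
    by_cases hx : x ∈ Set.Ioi ε
    · have hx' : ε < x := hx
      have hx0 : 0 < x := hε.trans hx'
      rw [Set.indicator_of_mem hx, Real.norm_of_nonneg (by positivity)]
      gcongr
    · rw [Set.indicator_of_notMem hx, norm_zero]
      positivity
  -- At `x = ε` both indicators below vanish, so this point is discarded.
  have hne : ∀ᵐ x ∂(gammaMeasure m 1), x ≠ ε :=
    compl_mem_ae_iff.2 (withDensity_absolutelyContinuous _ _ (measure_singleton ε))
  calc ∫ x, (if x < ε then 1 else (gammaMeasure m 1).real (Set.Iio (ε * (c / x))))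
        ∂(gammaMeasure m 1)
      ≤ ∫ x, (Set.indicator (Set.Iio ε) (1 : ℝ → ℝ) x +
          Set.indicator (Set.Ioi ε) (fun x : ℝ => A * (x ^ m)⁻¹) x) ∂(gammaMeasure m 1) := by
        refine integral_mono_of_nonneg (ae_of_all _ fun x => ?_) (hi1.add hi2) ?_
        · dsimp only
          split_ifs <;> simp
        · filter_upwards [hne] with x hx
          split_ifs with h
          · rw [Set.indicator_of_mem (by exact h), Set.indicator_of_notMem (by simpa using h.le)]
            simp
          · have hx' : ε < x := lt_of_le_of_ne (not_lt.1 h) (Ne.symm hx)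
            have hx0 : 0 < x := hε.trans hx'
            rw [Set.indicator_of_notMem (by exact h), Set.indicator_of_mem (by exact hx'), zero_add]
            refine (gammaMeasure_real_Iio_le hm (by positivity)).trans (le_of_eq ?_)
            rw [hA, mul_div_assoc', div_pow, mul_comm ε]
            ring
    _ ≤ ε ^ m / m.factorial + A * (((m - 1).factorial : ℝ)⁻¹ * (-Real.log ε + 1)) := by
        rw [integral_add hi1 hi2]
        refine add_le_add ?_ ?_
        · rw [integral_indicator_one measurableSet_Iio]
          exact gammaMeasure_real_Iio_le hm hε.le
        · rw [integral_indicator measurableSet_Ioi, integral_const_mul,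
            setIntegral_gammaMeasure hm measurableSet_Ioi (Set.Ioi_subset_Ioi hε.le),
            setIntegral_congr_fun measurableSet_Ioi
              fun x hx => gammaWeight_mul_inv_pow_self hm (hε.trans hx),
            integral_const_mul]
          gcongr
          exact setIntegral_inv_mul_exp_neg_le hε hε1
    _ = _ := by
        rw [hA, mul_pow]
        field_simp

/-- Restrict the first gain to `(a, b]`. The losses are `exp (-(ε * c / a))` from the second gain's
distribution function and `exp (-b)` from the density; `log (b / a)` is the integral of `1 / x`. -/
lemma le_gammaOutage_self {m : ℕ} (hm : 1 ≤ m) {c ε a b : ℝ} (hc : 0 < c) (hε : 0 < ε)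
    (ha : ε ≤ a) (hab : a ≤ b) :
    ε ^ m * (c ^ m / (m.factorial * (m - 1).factorial) *
      (Real.exp (-(ε * c / a)) * Real.exp (-b) * Real.log (b / a))) ≤ gammaOutage m m c ε := by
  have := isProbabilityMeasure_gammaMeasure_natCast hm
  have hG := measurable_gammaMeasure_real_Iio m hm
  have ha0 : 0 < a := hε.trans_le ha
  have hS : Set.Ioc a b ⊆ Set.Ioi 0 := fun x hx => ha0.trans hx.1
  rw [gammaOutage_eq_integral_left hm hm hc]
  set A : ℝ := (c * ε) ^ m / m.factorial with hA
  have hA0 : 0 ≤ A := by positivity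
  set B : ℝ := Real.exp (-(ε * c / a)) with hB
  have hf : Integrable (fun x => if x < ε then (1 : ℝ) else
      (gammaMeasure m 1).real (Set.Iio (ε * (c / x)))) (gammaMeasure m 1) := by
    refine Integrable.of_bound (Measurable.aestronglyMeasurable
      (Measurable.ite measurableSet_Iio measurable_const (hG.comp (by fun_prop)))) 1
      (ae_of_all _ fun x => ?_)
    split_ifs
    · simp
    · rw [Real.norm_of_nonneg measureReal_nonneg]
      exact measureReal_le_one
  have hbound : ∀ x ∈ Set.Ioc a b, ‖(x ^ m)⁻¹‖ ≤ (a ^ m)⁻¹ := fun x hx => by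
    have hx0 : 0 < x := hS hx
    rw [Real.norm_of_nonneg (by positivity)]
    gcongr
    exact hx.1.le
  have hi1 : IntegrableOn (fun x : ℝ => B * A * (x ^ m)⁻¹) (Set.Ioc a b) (gammaMeasure m 1) := by
    refine Integrable.const_mul ?_ _
    exact Integrable.of_bound (Measurable.aestronglyMeasurable (by fun_prop)) (a ^ m)⁻¹
      (by filter_upwards [self_mem_ae_restrict measurableSet_Ioc] with x hx using hbound x hx)
  have hinv : ContinuousOn (fun x : ℝ => x⁻¹) (Set.Icc a b) :=
    ContinuousOn.inv₀ continuousOn_id fun x hx => (ha0.trans_le hx.1).ne'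
  calc _ = B * A * (((m - 1).factorial : ℝ)⁻¹ * (Real.exp (-b) * Real.log (b / a))) := by
        rw [hA, mul_pow]
        field_simp
    _ = B * A * ∫ x in Set.Ioc a b, ((m - 1).factorial : ℝ)⁻¹ * (Real.exp (-b) * x⁻¹) := by
        rw [integral_const_mul, integral_const_mul, ← intervalIntegral.integral_of_le hab,
          integral_inv_of_pos ha0 (ha0.trans_le hab)]
    _ ≤ B * A * ∫ x in Set.Ioc a b, ((m - 1).factorial : ℝ)⁻¹ * (x⁻¹ * Real.exp (-x)) := by
        refine mul_le_mul_of_nonneg_left (setIntegral_mono_on ?_ ?_ measurableSet_Ioc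
          fun x hx => ?_) (by positivity)
        · exact (ContinuousOn.integrableOn_Icc (by fun_prop)).mono_set Set.Ioc_subset_Icc_self
        · exact (ContinuousOn.integrableOn_Icc (by fun_prop)).mono_set Set.Ioc_subset_Icc_self
        · have hx0 : 0 < x := hS hx
          rw [mul_comm (Real.exp (-b))]
          gcongr
          exact hx.2
    _ = ∫ x in Set.Ioc a b, B * A * (x ^ m)⁻¹ ∂(gammaMeasure m 1) := by
        rw [integral_const_mul (μ := (gammaMeasure m 1).restrict (Set.Ioc a b)) (B * A),
          setIntegral_gammaMeasure hm measurableSet_Ioc hS, setIntegral_congr_fun measurableSet_Ioc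
            fun x hx => gammaWeight_mul_inv_pow_self hm (hS hx)]
    _ ≤ ∫ x in Set.Ioc a b, (if x < ε then (1 : ℝ) else
          (gammaMeasure m 1).real (Set.Iio (ε * (c / x)))) ∂(gammaMeasure m 1) := by
        refine setIntegral_mono_on hi1 hf.integrableOn measurableSet_Ioc fun x hx => ?_
        have hx0 : 0 < x := hS hx
        rw [if_neg (not_lt.2 (ha.trans hx.1.le))]
        calc B * A * (x ^ m)⁻¹ = B * ((ε * (c / x)) ^ m / m.factorial) := by
              rw [hA, mul_div_assoc' ε, div_pow, mul_comm ε]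
              ring
          _ ≤ Real.exp (-(ε * (c / x))) * ((ε * (c / x)) ^ m / m.factorial) := by
              rw [hB, mul_div_assoc' ε]
              gcongr
              exact hx.1.le
          _ ≤ _ := le_gammaMeasure_real_Iio hm (by positivity)
    _ ≤ _ := by
        refine setIntegral_le_integral hf (ae_of_all _ fun x => ?_)
        dsimp only
        split_ifs <;> simp

/-- Outage when both hops have the same shape. -/
lemma tendsto_gammaOutage_self {m : ℕ} (hm : 1 ≤ m) {c : ℝ} (hc : 0 < c) :
    Tendsto (fun ε => gammaOutage m m c ε / (ε ^ m * (-Real.log ε))) (𝓝[>] 0)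
      (𝓝 (c ^ m / (m.factorial * (m - 1).factorial))) := by
  set K : ℝ := c ^ m / (m.factorial * (m - 1).factorial) with hK
  have hL : Tendsto (fun ε : ℝ => -Real.log ε) (𝓝[>] 0) atTop :=
    tendsto_neg_atBot_atTop.comp Real.tendsto_log_nhdsGT_zero
  have hinv : Tendsto (fun L : ℝ => L⁻¹) atTop (𝓝 0) := tendsto_inv_atTop_zero
  have hlog : Tendsto (fun L : ℝ => Real.log L / L) atTop (𝓝 0) :=
    Real.isLittleO_log_id_atTop.tendsto_div_nhds_zero
  have hlow : Tendsto (fun L : ℝ => K * (Real.exp (-(c * L⁻¹)) * Real.exp (-L⁻¹) *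
      (1 - 2 * (Real.log L / L)))) atTop (𝓝 K) := by
    have h1 : Tendsto (fun L : ℝ => Real.exp (-(c * L⁻¹))) atTop (𝓝 1) := by
      have := (Real.continuous_exp.tendsto _).comp (hinv.const_mul c).neg
      simpa [Function.comp_def] using this
    have h2 : Tendsto (fun L : ℝ => Real.exp (-L⁻¹)) atTop (𝓝 1) := by
      have := (Real.continuous_exp.tendsto _).comp hinv.neg
      simpa [Function.comp_def] using this
    have h3 := ((h1.mul h2).mul (tendsto_const_nhds (x := (1 : ℝ)) |>.sub (hlog.const_mul 2))).const_mul K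
    simpa using h3
  have hup : Tendsto (fun L : ℝ => 1 / m.factorial * L⁻¹ + K * (1 + L⁻¹)) atTop (𝓝 K) := by
    have h3 := (hinv.const_mul (1 / (m.factorial : ℝ))).add
      ((tendsto_const_nhds (x := (1 : ℝ)) |>.add hinv).const_mul K)
    simpa using h3
  -- With `L = -log ε` this says `ε * L ≤ 1 / L`, the order of the endpoints chosen below.
  have hsmall : ∀ᶠ L : ℝ in atTop, L ^ 2 * Real.exp (-L) ≤ 1 :=
    (Real.tendsto_pow_mul_exp_neg_atTop_nhds_zero 2).eventually_le_const one_pos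
  refine tendsto_of_tendsto_of_tendsto_of_le_of_le' (hlow.comp hL) (hup.comp hL) ?_ ?_
  · filter_upwards [self_mem_nhdsWithin, hL.eventually hsmall, hL.eventually (eventually_ge_atTop 1)]
      with ε hε hs hL1
    have hε0 : 0 < ε := hε
    simp only [Function.comp_apply]
    rw [neg_neg, Real.exp_log hε0] at hs
    set L := -Real.log ε with hLdef
    have hL0 : 0 < L := by linarith
    rw [le_div_iff₀ (by positivity)]
    -- Here `ε * c / a = c / L` and `b = 1 / L` both tend to 0, while `log (b / a) = L - 2 * log L`
    -- is still equivalent to `L`.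
    refine le_trans (le_of_eq ?_) (le_gammaOutage_self hm hc hε0 (a := ε * L) (b := L⁻¹) ?_ ?_)
    · have h1 : Real.log (L⁻¹ / (ε * L)) = L - 2 * Real.log L := by
        rw [Real.log_div (by positivity) (by positivity), Real.log_inv,
          Real.log_mul (by positivity) (by positivity)]
        linarith
      rw [h1, mul_div_mul_left _ _ hε0.ne', div_eq_mul_inv c, ← hK]
      field_simp
    · exact le_mul_of_one_le_right hε0.le hL1
    · rw [← one_div, le_div_iff₀ hL0]
      linarith
  · filter_upwards [self_mem_nhdsWithin, nhdsWithin_le_nhds (Iio_mem_nhds one_pos),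
      hL.eventually (eventually_ge_atTop 1)] with ε hε hε1 hL1
    have hε0 : 0 < ε := hε
    simp only [Function.comp_apply]
    have hL0 : 0 < -Real.log ε := by linarith
    rw [div_le_iff₀ (by positivity)]
    refine (gammaOutage_self_le hm hc hε0 (le_of_lt hε1)).trans (le_of_eq ?_)
    rw [← hK]
    have := hL0.ne'
    generalize -Real.log ε = L at *
    field_simp

/-! ### The series as an expectation -/

lemma hasSum_integral_pow_mul_exp_neg (j : ℕ) {c : ℝ} (hc : 0 ≤ c) :
    HasSum (fun k : ℕ => (-1) ^ k / (k.factorial : ℝ) * (c ^ (j + k + 1) / (j + k + 1)))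
      (∫ y in (0)..c, y ^ j * Real.exp (-y)) := by
  have h := intervalIntegral.hasSum_integral_of_dominated_convergence (μ := volume) (a := 0)
    (b := c) (F := fun k y => (-1) ^ k / (k.factorial : ℝ) * y ^ (j + k))
    (f := fun y => y ^ j * Real.exp (-y))
    (fun k _ => c ^ j * (c ^ k / k.factorial)) (fun k => by fun_prop) ?_ ?_ ?_ ?_
  · refine h.congr_fun fun k => ?_
    rw [intervalIntegral.integral_const_mul, integral_pow]
    simp
  · refine fun k => ae_of_all _ fun y hy => ?_
    rw [Set.uIoc_of_le hc] at hy
    rw [norm_mul, norm_div, norm_pow, norm_pow, norm_neg, norm_one, one_pow,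
      Real.norm_of_nonneg (by positivity : (0 : ℝ) ≤ k.factorial), Real.norm_of_nonneg hy.1.le,
      mul_div_assoc', ← pow_add, one_div, div_eq_inv_mul]
    gcongr
    exact hy.1.le
    exact hy.2
  · exact ae_of_all _ fun y _ => (Real.summable_pow_div_factorial c).mul_left _
  · exact intervalIntegrable_const
  · refine ae_of_all _ fun y _ => ?_
    have h1 : HasSum (fun k : ℕ => (-y) ^ k / (k.factorial : ℝ)) (Real.exp (-y)) := by
      rw [Real.exp_eq_exp_ℝ]
      exact NormedSpace.expSeries_div_hasSum_exp (-y)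
    refine (h1.mul_left (y ^ j)).congr_fun fun k => ?_
    rw [neg_pow, pow_add]
    ring

/-- With `q = n - m + k`, partial fractions `1 / (q * (m + q)) = (1 / q - 1 / (m + q)) / m` split
each term into those of two termwise integrated exponential series. -/
lemma hasSum_tzfSeriesTerm {m n : ℕ} (hm : 1 ≤ m) (h : m < n) {c : ℝ} (hc : 0 < c) :
    HasSum (tzfSeriesTerm m (n + 1) c)
      ((c ^ m * (∫ y in (0)..c, y ^ (n - m - 1) * Real.exp (-y)) -
        ∫ y in (0)..c, y ^ (n - 1) * Real.exp (-y)) / m) := by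
  have h1 := (hasSum_integral_pow_mul_exp_neg (n - m - 1) hc.le).mul_left (c ^ m)
  have h2 := hasSum_integral_pow_mul_exp_neg (n - 1) hc.le
  refine ((h1.sub h2).div_const (m : ℝ)).congr_fun fun k => ?_
  obtain ⟨p, rfl⟩ : ∃ p, n = m + p + 1 := ⟨n - m - 1, by omega⟩
  rw [show m + p + 1 - m - 1 = p by omega, show m + p + 1 - 1 = m + p by omega, tzfSeriesTerm,
    show m + p + 1 + 1 + k - 1 = m + (p + k + 1) by omega,
    show m + p + k + 1 = m + (p + k + 1) by omega, pow_add c m, pow_succ (-1 : ℝ) k]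
  have hm0 : (m : ℝ) ≠ 0 := by positivity
  have hp : (p : ℝ) + k + 1 ≠ 0 := by positivity
  have hq : (m : ℝ) + p + k + 1 ≠ 0 := by positivity
  have e1 : (k : ℝ) + ((m + p + 1 + 1 : ℕ) : ℝ) - 1 = m + p + k + 1 := by push_cast; ring
  have e2 : (m : ℝ) - ((m + p + 1 + 1 : ℕ) : ℝ) - k + 1 = -(p + k + 1) := by push_cast; ring
  rw [e1, e2]
  push_cast
  field_simp
  ring

/-- The maximum exceeds 1 only for `y < c`, so the expectation is 1 plus an integral of `(c / y) ^ m
- 1` over `(0, c]`. -/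
lemma integral_max_pow_gammaMeasure {m n : ℕ} (hm : 1 ≤ m) (h : m < n) {c : ℝ} (hc : 0 < c) :
    ∫ y, max 1 (c / y) ^ m / m.factorial ∂(gammaMeasure n 1) =
      1 / m.factorial + 1 / ((n - 1).factorial * (m - 1).factorial) *
        ∑' k, tzfSeriesTerm m (n + 1) c k := by
  have hn : 1 ≤ n := by omega
  have := isProbabilityMeasure_gammaMeasure_natCast hn
  have hint : Integrable (fun y : ℝ => c ^ m * (y ^ m)⁻¹ - 1) (gammaMeasure n 1) :=
    ((integrable_inv_pow_gammaMeasure h).const_mul _).sub (integrable_const 1)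
  have h1 : ∫ y, max 1 (c / y) ^ m ∂(gammaMeasure n 1) =
      1 + ∫ y in Set.Ioc 0 c, (c ^ m * (y ^ m)⁻¹ - 1) ∂(gammaMeasure n 1) := by
    have h1a : ∫ y, max 1 (c / y) ^ m ∂(gammaMeasure n 1) = ∫ y, (1 +
        (Set.Ioc 0 c).indicator (fun y => c ^ m * (y ^ m)⁻¹ - 1) y) ∂(gammaMeasure n 1) := by
      refine integral_congr_ae ?_
      filter_upwards [ae_pos_gammaMeasure] with y hy
      by_cases hyc : y ≤ c
      · rw [Set.indicator_of_mem (Set.mem_Ioc.2 ⟨hy, hyc⟩), max_eq_right ((one_le_div hy).2 hyc), div_pow]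
        ring
      · rw [Set.indicator_of_notMem fun hy' => hyc hy'.2,
          max_eq_left ((div_le_one hy).2 (not_le.1 hyc).le)]
        simp
    rw [h1a, integral_add (integrable_const 1) (hint.indicator measurableSet_Ioc),
      integral_indicator measurableSet_Ioc]
    simp
  have hcont (j : ℕ) : IntervalIntegrable (fun y : ℝ => y ^ j * Real.exp (-y)) volume 0 c :=
    Continuous.intervalIntegrable (by fun_prop) _ _
  have h2 : ∫ y in Set.Ioc 0 c, (c ^ m * (y ^ m)⁻¹ - 1) ∂(gammaMeasure n 1) =
      ((n - 1).factorial : ℝ)⁻¹ * (c ^ m * (∫ y in (0)..c, y ^ (n - m - 1) * Real.exp (-y)) -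
        ∫ y in (0)..c, y ^ (n - 1) * Real.exp (-y)) := by
    rw [setIntegral_gammaMeasure hn measurableSet_Ioc (fun y hy => hy.1),
      ← intervalIntegral.integral_const_mul, ← intervalIntegral.integral_sub
        ((hcont _).const_mul _) (hcont _), ← intervalIntegral.integral_const_mul,
      intervalIntegral.integral_of_le hc.le]
    refine setIntegral_congr_fun measurableSet_Ioc fun y hy => ?_
    have := gammaWeight_mul_inv_pow h hy.1
    rw [mul_sub, mul_left_comm, this]
    ring
  have hmf : (m.factorial : ℝ) = m * (m - 1).factorial := by
    exact_mod_cast (Nat.mul_factorial_pred (by omega)).symm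
  have hm0 : (m : ℝ) ≠ 0 := by positivity
  rw [integral_div, h1, h2, (hasSum_tzfSeriesTerm hm h hc).tsum_eq, hmf]
  field_simp

/-! ### From limits to equivalence and diversity order -/

lemma isEquivalent_of_tendsto_div {l : Filter ℝ} {F A g : ℝ → ℝ} {C : ℝ} (hC : C ≠ 0)
    (hg : ∀ᶠ x in l, g x ≠ 0) (hF : Tendsto (fun x => F x / g x) l (𝓝 C))
    (hA : Tendsto (fun x => A x / g x) l (𝓝 C)) : F ~[l] A := by
  have hA0 := hA.eventually_ne hC
  rw [isEquivalent_iff_tendsto_one]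
  · have := hF.div hA hC
    rw [div_self hC] at this
    refine this.congr' ?_
    filter_upwards [hg] with x hx
    exact div_div_div_cancel_right₀ hx _ _
  · filter_upwards [hA0] with x hx h0
    simp [h0] at hx

/-- `log F` and `log g` differ by a convergent quantity, negligible against `log ρ`. -/
lemma tendsto_neg_log_div_log {F g : ℝ → ℝ} {C k : ℝ} (hC : 0 < C) (hg : ∀ᶠ ρ in atTop, 0 < g ρ)
    (hF : Tendsto (fun ρ => F ρ / g ρ) atTop (𝓝 C))
    (hk : Tendsto (fun ρ => -Real.log (g ρ) / Real.log ρ) atTop (𝓝 k)) :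
    Tendsto (fun ρ => -Real.log (F ρ) / Real.log ρ) atTop (𝓝 k) := by
  have h1 : Tendsto (fun ρ => Real.log (F ρ / g ρ) / Real.log ρ) atTop (𝓝 0) :=
    ((Real.continuousAt_log hC.ne').tendsto.comp hF).div_atTop Real.tendsto_log_atTop
  have h2 := hk.sub h1
  rw [sub_zero] at h2
  refine h2.congr' ?_
  filter_upwards [hg, hF.eventually (lt_mem_nhds hC)] with ρ hgρ hFρ
  have hFpos : 0 < F ρ := by
    have := mul_pos hFρ hgρ
    rwa [div_mul_cancel₀ _ hgρ.ne'] at this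
  rw [Real.log_div hFpos.ne' hgρ.ne']
  ring

lemma tendsto_neg_log_pow_div_log {b : ℝ} (hb : 0 < b) (k : ℕ) :
    Tendsto (fun ρ => -Real.log ((b / ρ) ^ k) / Real.log ρ) atTop (𝓝 k) := by
  have h1 : Tendsto (fun ρ => (k : ℝ) - k * Real.log b / Real.log ρ) atTop (𝓝 (k - 0)) :=
    tendsto_const_nhds.sub (tendsto_const_nhds.div_atTop Real.tendsto_log_atTop)
  rw [sub_zero] at h1
  refine h1.congr' ?_
  filter_upwards [eventually_gt_atTop 1] with ρ hρ
  have hl := Real.log_pos hρ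
  rw [Real.log_pow, Real.log_div hb.ne' (by positivity)]
  field_simp
  ring

lemma tendsto_log_sub_div_self (β : ℝ) :
    Tendsto (fun t => Real.log (t - β) / t) atTop (𝓝 0) := by
  have h1 : Tendsto (fun t : ℝ => t - β) atTop atTop := tendsto_atTop_add_const_right _ _ tendsto_id
  have h2 := Real.isLittleO_log_id_atTop.tendsto_div_nhds_zero.comp h1
  have h3 : Tendsto (fun t : ℝ => 1 - β / t) atTop (𝓝 (1 - 0)) :=
    tendsto_const_nhds.sub (tendsto_const_nhds.div_atTop tendsto_id)
  have h4 := h2.mul h3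
  rw [zero_mul] at h4
  refine h4.congr' ?_
  filter_upwards [eventually_gt_atTop 0, eventually_gt_atTop β] with t ht htβ
  have : t - β ≠ 0 := by linarith
  simp only [Function.comp_apply, id]
  field_simp

/-- The extra logarithmic factor contributes only `log (log ρ - log b)`. -/
lemma tendsto_neg_log_pow_mul_log_div_log {b : ℝ} (hb : 0 < b) (k : ℕ) :
    Tendsto (fun ρ => -Real.log ((b / ρ) ^ k * -Real.log (b / ρ)) / Real.log ρ) atTop (𝓝 k) := by
  have h1 := (tendsto_neg_log_pow_div_log hb k).sub
    ((tendsto_log_sub_div_self (Real.log b)).comp Real.tendsto_log_atTop)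
  rw [sub_zero] at h1
  refine h1.congr' ?_
  filter_upwards [eventually_gt_atTop 0, eventually_gt_atTop b] with ρ hρ hρb
  have hl : Real.log b < Real.log ρ := Real.log_lt_log hb hρb
  have h2 : -Real.log (b / ρ) = Real.log ρ - Real.log b := by
    rw [Real.log_div hb.ne' hρ.ne']
    ring
  rw [h2, Real.log_mul (by positivity) (by linarith)]
  simp only [Function.comp_apply]
  ring

theorem proposition1 {Ω : Type*} [MeasurableSpace Ω] (P : Measure Ω) [IsProbabilityMeasure P]
    (MR MT : ℕ) (hMR : 1 ≤ MR) (hMT : 1 < MT)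
    (η α d₁ d₂ τ z : ℝ) (σ2 : ℝ≥0) (hη : 0 < η) (hα₀ : 0 < α) (hα₁ : α < 1)
    (hd₁ : 0 < d₁) (hd₂ : 0 < d₂) (hz : 0 < z) (hσ2 : 0 < σ2)
    (hSR : Ω → Fin MR → ℂ) (HRR : Ω → Matrix (Fin MR) (Fin MT) ℂ) (hRD : Ω → Fin MT → ℂ)
    (hfading : IsRayleighFading P σ2 hSR HRR hRD)
    (wt : Ω → Fin MT → ℂ)
    (hwt : ∀ᵐ ω ∂P, IsTransmitZF (hSR ω) (HRR ω) (hRD ω) (wt ω)) :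
    (MR + 1 < MT → Summable (tzfSeriesTerm MR MT (d₂ ^ τ / harvestFactor η α))) ∧
    ((fun ρ₁ : ℝ => outageTZF P η α d₁ d₂ τ hSR HRR hRD wt z ρ₁) ~[atTop]
      (fun ρ₁ : ℝ => tzfAsymptotic MR MT (harvestFactor η α) d₁ d₂ τ z ρ₁)) ∧
    Tendsto (fun ρ₁ : ℝ =>
        -Real.log (outageTZF P η α d₁ d₂ τ hSR HRR hRD wt z ρ₁) / Real.log ρ₁)
      atTop (𝓝 (min (MR : ℝ) ((MT : ℝ) - 1))) := by
  obtain ⟨n, rfl⟩ : ∃ n, MT = n + 1 := ⟨MT - 1, by omega⟩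
  have hn : 1 ≤ n := by omega
  have hκ : 0 < harvestFactor η α := div_pos (mul_pos hη hα₀) (by linarith)
  have hc : 0 < d₂ ^ τ / harvestFactor η α := div_pos (Real.rpow_pos_of_pos hd₂ τ) hκ
  have hb : 0 < d₁ ^ τ * z := mul_pos (Real.rpow_pos_of_pos hd₁ τ) hz
  have hout : ∀ᶠ ρ in atTop, outageTZF P η α d₁ d₂ τ hSR HRR hRD wt z ρ =
      gammaOutage MR n (d₂ ^ τ / harvestFactor η α) (d₁ ^ τ * z / ρ) := by
    filter_upwards [eventually_gt_atTop 0] with ρ hρ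
    exact outageTZF_eq_gammaOutage hMR hn hκ hd₁ hd₂ hσ2.ne' hfading hwt hρ
  have hε : Tendsto (fun ρ : ℝ => d₁ ^ τ * z / ρ) atTop (𝓝[>] 0) := by
    refine tendsto_nhdsWithin_iff.2 ⟨tendsto_const_nhds.div_atTop tendsto_id, ?_⟩
    filter_upwards [eventually_gt_atTop 0] with ρ hρ
    exact div_pos hb hρ
  have hΓR := gamma_natCast_of_one_le hMR
  have hΓR' := Real.Gamma_nat_eq_factorial MR
  have hΓn := gamma_natCast_of_one_le hn
  have hcast : ((n + 1 : ℕ) : ℝ) - 1 = n := by push_cast; ring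
  have hpow (k : ℕ) : ∀ᶠ ρ : ℝ in atTop, 0 < (d₁ ^ τ * z / ρ) ^ k := by
    filter_upwards [eventually_gt_atTop 0] with ρ hρ
    positivity
  unfold tzfAsymptotic
  rw [hcast]
  generalize d₂ ^ τ / harvestFactor η α = c at hc hout ⊢
  generalize d₁ ^ τ * z = b at hb hout hε hpow ⊢
  refine ⟨fun h => (hasSum_tzfSeriesTerm hMR (by omega) hc).summable, ?_⟩
  rcases lt_trichotomy MR n with h | h | h
  · set C : ℝ := ∫ y, max 1 (c / y) ^ MR / MR.factorial ∂(gammaMeasure n 1) with hCdef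
    -- Positivity is read off the integral, since the alternating series does not show it.
    have hC : 0 < C := by
      have := isProbabilityMeasure_gammaMeasure_natCast hn
      have h1 : (0 : ℝ) < 1 / MR.factorial := by positivity
      refine h1.trans_le ?_
      have h2 : ∫ _, (1 : ℝ) / MR.factorial ∂(gammaMeasure n 1) ≤ C := by
        refine integral_mono (integrable_const _) (integrable_max_pow_gammaMeasure h hc) fun y => ?_
        dsimp only
        gcongr
        exact one_le_pow₀ (le_max_left _ _)
      simpa using h2
    have hlim : Tendsto (fun ρ => outageTZF P η α d₁ d₂ τ hSR HRR hRD wt z ρ / (b / ρ) ^ MR)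
        atTop (𝓝 C) := by
      refine ((tendsto_gammaOutage_of_lt hMR h hc).comp hε).congr' ?_
      filter_upwards [hout] with ρ hρ
      rw [hρ, Function.comp_apply]
    refine ⟨isEquivalent_of_tendsto_div hC.ne' ((hpow MR).mono fun _ h => h.ne') hlim ?_, ?_⟩
    · refine tendsto_const_nhds.congr' ?_
      filter_upwards [hpow MR] with ρ hρ
      rw [if_pos (by omega), mul_div_cancel_right₀ _ hρ.ne', hCdef,
        integral_max_pow_gammaMeasure hMR h hc, hΓR', hΓR, hΓn]
    · rw [min_eq_left (by exact_mod_cast h.le)]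
      exact tendsto_neg_log_div_log hC (hpow MR) hlim (tendsto_neg_log_pow_div_log hb MR)
  · subst h
    have hC : 0 < c ^ MR / (MR.factorial * (MR - 1).factorial) := by positivity
    have hL : ∀ᶠ ρ : ℝ in atTop, 0 < -Real.log (b / ρ) := by
      filter_upwards [eventually_gt_atTop 0, eventually_gt_atTop b] with ρ hρ hρb
      rw [neg_pos]
      exact Real.log_neg (div_pos hb hρ) ((div_lt_one hρ).2 hρb)
    have hLtop : Tendsto (fun ρ : ℝ => -Real.log (b / ρ)) atTop atTop :=
      (tendsto_neg_atBot_atTop.comp Real.tendsto_log_nhdsGT_zero).comp hε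
    have hg : ∀ᶠ ρ : ℝ in atTop, 0 < (b / ρ) ^ MR * -Real.log (b / ρ) := by
      filter_upwards [hpow MR, hL] with ρ h1 h2
      exact mul_pos h1 h2
    have hlim : Tendsto (fun ρ => outageTZF P η α d₁ d₂ τ hSR HRR hRD wt z ρ /
        ((b / ρ) ^ MR * -Real.log (b / ρ))) atTop
        (𝓝 (c ^ MR / (MR.factorial * (MR - 1).factorial))) := by
      refine ((tendsto_gammaOutage_self hMR hc).comp hε).congr' ?_
      filter_upwards [hout] with ρ hρ
      rw [hρ, Function.comp_apply]
    refine ⟨isEquivalent_of_tendsto_div hC.ne' (hg.mono fun _ h => h.ne') hlim ?_, ?_⟩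
    -- After division by the gauge, everything but the logarithm's coefficient, the `ψ(1)` term
    -- included, is a constant over `-log (b / ρ)` and vanishes.
    · have h1 : Tendsto (fun ρ : ℝ => 1 / (MR.factorial : ℝ) *
          ((1 + 1 / (MR - 1).factorial * (Complex.digamma 1).re * c ^ MR) /
            (-Real.log (b / ρ)) + 1 / (MR - 1).factorial * c ^ MR)) atTop
          (𝓝 (1 / (MR.factorial : ℝ) * (0 + 1 / (MR - 1).factorial * c ^ MR))) :=
        ((tendsto_const_nhds.div_atTop hLtop).add_const _).const_mul _
      have h2 : 1 / (MR.factorial : ℝ) * (0 + 1 / (MR - 1).factorial * c ^ MR) =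
          c ^ MR / (MR.factorial * (MR - 1).factorial) := by
        field_simp
        ring
      rw [h2] at h1
      refine h1.congr' ?_
      filter_upwards [hpow MR, hL, eventually_gt_atTop 0] with ρ h3 h4 h5
      have h6 : Real.log ρ - Real.log b = -Real.log (b / ρ) := by
        rw [Real.log_div hb.ne' h5.ne']
        ring
      rw [if_neg (by omega), if_pos rfl, h6, hΓR', hΓR]
      have h3' := h3.ne'
      have h4' := h4.ne'
      generalize -Real.log (b / ρ) = L at *
      generalize (b / ρ) ^ MR = x at *
      field_simp
      ring
    · rw [min_self]
      exact tendsto_neg_log_div_log hC hg hlim (tendsto_neg_log_pow_mul_log_div_log hb MR)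
  · have hC : 0 < c ^ n / n.factorial * (((MR - n - 1).factorial : ℝ) / (MR - 1).factorial) := by
      positivity
    have hlim : Tendsto (fun ρ => outageTZF P η α d₁ d₂ τ hSR HRR hRD wt z ρ / (b / ρ) ^ n)
        atTop (𝓝 (c ^ n / n.factorial * (((MR - n - 1).factorial : ℝ) / (MR - 1).factorial))) := by
      refine ((tendsto_gammaOutage_of_gt hn h hc).comp hε).congr' ?_
      filter_upwards [hout] with ρ hρ
      rw [hρ, Function.comp_apply]
    refine ⟨isEquivalent_of_tendsto_div hC.ne' ((hpow n).mono fun _ h => h.ne') hlim ?_, ?_⟩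
    · refine tendsto_const_nhds.congr' ?_
      filter_upwards [hpow n] with ρ hρ
      have h1 : (MR : ℝ) - ((n + 1 : ℕ) : ℝ) + 1 = ((MR - n : ℕ) : ℝ) := by
        push_cast [h.le]
        ring
      rw [if_neg (by omega), if_neg (by omega), Nat.add_sub_cancel, mul_div_cancel_right₀ _ hρ.ne',
        h1, gamma_natCast_of_one_le (by omega : 1 ≤ MR - n),
        gamma_natCast_of_one_le (by omega : 1 ≤ n + 1), Nat.add_sub_cancel, hΓR]
      field_simp
    · rw [min_eq_right (by exact_mod_cast h.le)]
      exact tendsto_neg_log_div_log hC (hpow n) hlim (tendsto_neg_log_pow_div_log hb n)
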